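/- Let $p$ be a prime, let $L\subset\overline{\mathbb Q}_p$ be a finite extension of $\mathbb Q_p$ and let $L'\subset\overline{\mathbb Q}_p$ be a finite Galois extension of $L$. Let $k'$ be the residue field of $L'$ and let $L'_0=\mathrm{Frac}\,W(k')$ be the maximal unramified subfield of $L'$, with its Frobenius $\varphi'_0$ (raising each Witt component to the $p$-th power) and its natural action of $\mathrm{Gal}(L'/L)$. Let $K$ be a finite extension of $\mathbb Q_p$ such that $[L'_0:\mathbb Q_p]=|\mathrm{Hom}_{\mathbb Q_p}(L'_0,K)|$, and fix an embedding $\sigma'_0:L'_0\hookrightarrow K$. Let $W(\overline{\mathbb Q}_p/L)\subset\mathrm{Gal}(\overline{\mathbb Q}_p/L)$ be the Weil group of $L$; for $w\in W(\overline{\mathbb Q}_p/L)$ let $\alpha(w)\in\mathbb Z$ be the unique integer such that $w$ acts on the residue field $\overline{\mathbb F}_p$ as the $\alpha(w)$-th power of $x\mapsto x^p$, and let $\overline w$ be the image of $w$ in $\mathrm{Gal}(L'/L)$. Let $\mathrm{MOD}_{L'/L}$ be the category of free $L'_0\otimes_{\mathbb Q_p}K$-modules $D$ of finite rank equipped with *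 an additive bijection $\varphi:D\to D$ such that $\varphi((\ell\otimes k)d)=(\varphi'_0(\ell)\otimes k)\varphi(d)$, * an $L'_0\otimes_{\mathbb Q_p}K$-linear endomorphism $N$ such that $N\varphi=p\varphi N$, * an additive action of $\mathrm{Gal}(L'/L)$ that commutes with $\varphi$ and $N$ and satisfies $g((\ell\otimes k)d)=(g(\ell)\otimes k)g(d)$, the morphisms being the $L'_0\otimes_{\mathbb Q_p}K$-linear maps that commute with $\varphi$, $N$ and $\mathrm{Gal}(L'/L)$. Let $\mathrm{WD}_{L'/L}$ be the category of representations $(r,N,V)$ of the Weil–Deligne group of $L$ on finite dimensional $K$-vector spaces $V$ such that $r$ is unramified on $W(\overline{\mathbb Q}_p/L')$. That is: $r:W(\overline{\mathbb Q}_p/L)\to\mathrm{GL}_K(V)$ is a homomorphism trivial on an open subgroup of the inertia group of $L$, $N$ is a nilpotent $K$-linear endomorphism of $V$ with $r(w)N=p^{\alpha(w)}Nr(w)$ for all $w$, and $r$ is trivial on the inertia group of $L'$. The morphisms are the $K$-linear maps that commute with $r$ and $N$. Fontaine's functor $\mathrm{WD}:\mathrm{MOD}_{L'/L}\to\mathrm{WD}_{L'/L}$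 sends $D$ to $V=D_{\sigma'_0}$, the part of $D$ on which $L'_0$ acts through $\sigma'_0$, with the endomorphism induced by $N$ and with $r(w)$ induced by $\overline w\circ\varphi^{-\alpha(w)}$. Then $\mathrm{WD}$ is an equivalence of categories. -/

import Mathlib

universe w u

open scoped TensorProduct

noncomputable section

namespace FontaineWD

section Fields

variable (p : ℕ) [Fact p.Prime] (E : Type*) [Field E] [Algebra ℚ_[p] E]
  [Algebra.IsAlgebraic ℚ_[p] E]

/-- The ring of integers of an algebraic extension `E` of `ℚ_p`: the elements whose absolute
value (the unique extension to `E` of the `p`-adic absolute value) is at most `1`. -/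
def integers : ValuationSubring E where
  carrier := {x | spectralNorm ℚ_[p] E x ≤ 1}
  mul_mem' {x y} hx hy :=
    (spectralNorm_mul (Algebra.IsAlgebraic.isAlgebraic x)
      (Algebra.IsAlgebraic.isAlgebraic y)).trans (mul_le_one₀ hx (spectralNorm_nonneg y) hy)
  one_mem' := spectralNorm_one.le
  add_mem' {x y} hx hy := (isNonarchimedean_spectralNorm x y).trans (max_le hx hy)
  zero_mem' := by simp [spectralNorm_zero]
  neg_mem' {x} hx := by
    simpa [spectralNorm_neg (Algebra.IsAlgebraic.isAlgebraic x)] using hx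
  mem_or_inv_mem' x := by
    let := spectralNorm.normedField ℚ_[p] E
    change ‖x‖ ≤ 1 ∨ ‖x⁻¹‖ ≤ 1
    rw [norm_inv]
    rcases le_total ‖x‖ 1 with h | h
    · exact Or.inl h
    · exact Or.inr (inv_le_one_of_one_le₀ h)

lemma mem_integers {x : E} : x ∈ integers p E ↔ spectralNorm ℚ_[p] E x ≤ 1 := Iff.rfl

/-- The residue field of an algebraic extension `E` of `ℚ_p`. -/
abbrev Residue : Type _ := IsLocalRing.ResidueField (integers p E)

/-- The structure map `ℤ_p → 𝓞_E`. -/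
def intMap : ℤ_[p] →+* integers p E :=
  ((algebraMap ℚ_[p] E).comp PadicInt.Coe.ringHom).codRestrict (integers p E).toSubring
    (fun x => by
      change spectralNorm ℚ_[p] E (algebraMap ℚ_[p] E x) ≤ 1
      rw [spectralNorm_extends]; exact x.2)

lemma isUnit_integers_iff (x : integers p E) :
    IsUnit x ↔ spectralNorm ℚ_[p] E (x : E) = 1 := by
  let := spectralNorm.normedField ℚ_[p] E
  change IsUnit x ↔ ‖(x : E)‖ = 1
  have hx : ‖(x : E)‖ ≤ 1 := x.2
  constructor
  · rintro ⟨u, rfl⟩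
    have h1 : ‖((u⁻¹ : (integers p E)ˣ) : integers p E).1‖ ≤ 1 := (u⁻¹ : (integers p E)ˣ).1.2
    have h2 : (u : integers p E).1 * ((u⁻¹ : (integers p E)ˣ) : integers p E).1 = 1 :=
      congrArg Subtype.val u.mul_inv
    have h3 := congrArg norm h2
    rw [norm_mul, norm_one] at h3
    nlinarith [norm_nonneg (u : integers p E).1]
  · intro h
    have h0 : (x : E) ≠ 0 := by rintro h0; simp [h0] at h
    have hi : ‖(x : E)⁻¹‖ ≤ 1 := by rw [norm_inv, h]; simp
    exact IsUnit.of_mul_eq_one (⟨(x : E)⁻¹, hi⟩ : integers p E)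
      (Subtype.ext (mul_inv_cancel₀ h0))

instance : CharP (Residue p E) p := by
  refine (CharP.charP_iff_prime_eq_zero Fact.out).2 ?_
  rw [← map_natCast (IsLocalRing.residue (integers p E)), IsLocalRing.residue_eq_zero_iff,
    IsLocalRing.mem_maximalIdeal, mem_nonunits_iff, isUnit_integers_iff]
  have : (((p : integers p E)) : E) = algebraMap ℚ_[p] E (p : ℚ_[p]) := by simp
  rw [this, spectralNorm_extends, Padic.norm_p]
  have hp := (Fact.out : p.Prime).one_lt
  have : (1 : ℝ) < p := by exact_mod_cast hp
  exact (inv_lt_one_of_one_lt₀ this).ne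

instance : Algebra (ZMod p) (Residue p E) := ZMod.algebra _ p

instance : Algebra.IsAlgebraic (ZMod p) (Residue p E) := by
  constructor
  intro y
  obtain ⟨x, rfl⟩ := IsLocalRing.residue_surjective y
  rw [isAlgebraic_iff_isIntegral]
  have hx := x.2
  rw [mem_integers, spectralNorm, spectralValue_le_one_iff
    (minpoly.monic (Algebra.IsAlgebraic.isAlgebraic (x : E)).isIntegral)] at hx
  have hl : minpoly ℚ_[p] (x : E) ∈ Polynomial.lifts (PadicInt.Coe.ringHom (p := p)) := by
    rw [Polynomial.lifts_iff_coeff_lifts]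
    intro n
    exact ⟨⟨_, hx n⟩, rfl⟩
  obtain ⟨f, hf, -, hm⟩ := Polynomial.lifts_and_natDegree_eq_and_monic hl
    (minpoly.monic (Algebra.IsAlgebraic.isAlgebraic (x : E)).isIntegral)
  have h1 : f.eval₂ (intMap p E) x = 0 := by
    apply Subtype.val_injective
    have h := minpoly.aeval ℚ_[p] (x : E)
    rw [← hf, Polynomial.aeval_def, Polynomial.eval₂_map] at h
    have := Polynomial.hom_eval₂ f (intMap p E) (integers p E).subtype x
    exact this.trans h
  have h2 : ((IsLocalRing.residue (integers p E)).comp (intMap p E)) =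
      (algebraMap (ZMod p) (Residue p E)).comp PadicInt.toZMod := by
    ext z
    obtain ⟨w, hw⟩ := Ideal.mem_span_singleton.1
      (PadicInt.maximalIdeal_eq_span_p (p := p) ▸ PadicInt.toZMod_spec z)
    have : z = (((PadicInt.toZMod z : ZMod p).val : ℕ) : ℤ_[p]) + p * w := by
      rw [← hw, ZMod.natCast_val]; ring
    rw [this]
    simp
  refine ⟨f.map PadicInt.toZMod, hm.map _, ?_⟩
  rw [Polynomial.eval₂_map, ← h2, ← Polynomial.hom_eval₂, h1, map_zero]

instance : PerfectField (Residue p E) := Algebra.IsAlgebraic.perfectField (ZMod p)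

instance : PerfectRing (Residue p E) p := PerfectField.toPerfectRing p

/-- The absolute arithmetic Frobenius `x ↦ x ^ p` of the residue field. -/
def residueFrob : RingAut (Residue p E) := frobeniusEquiv (Residue p E) p

variable {E} in
/-- The action of an automorphism of `E` on the ring of integers. -/
def integersAut : (E ≃ₐ[ℚ_[p]] E) →* RingAut (integers p E) where
  toFun σ :=
    { toFun := fun x => ⟨σ x, by
        rw [mem_integers, ← spectralNorm_eq_of_equiv]; exact x.2⟩
      invFun := fun x => ⟨σ.symm x, by
        rw [mem_integers, ← spectralNorm_eq_of_equiv]; exact x.2⟩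
      left_inv := fun x => by ext; simp
      right_inv := fun x => by ext; simp
      map_mul' := fun x y => by ext; simp
      map_add' := fun x y => by ext; simp }
  map_one' := rfl
  map_mul' _ _ := rfl

/-- The action of an automorphism of `E` on the residue field. -/
def residueAut : (E ≃ₐ[ℚ_[p]] E) →* RingAut (Residue p E) :=
  IsLocalRing.ResidueField.mapAut.comp (integersAut p)

end Fields

section Unramified

variable (p : ℕ) [Fact p.Prime] (E : Type*) [Field E] [Algebra ℚ_[p] E]
  [Algebra.IsAlgebraic ℚ_[p] E]

/-- The maximal unramified subfield `E₀` of `E` (for `E` finite over `ℚ_p`), in its standard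
description as `Frac W(k)`, where `k` is the residue field of `E`. -/
def MaxUnram : Type _ := FractionRing (WittVector p (Residue p E))

instance : Field (MaxUnram p E) :=
  inferInstanceAs (Field (FractionRing (WittVector p (Residue p E))))

instance : Algebra (WittVector p (Residue p E)) (MaxUnram p E) :=
  inferInstanceAs (Algebra _ (FractionRing (WittVector p (Residue p E))))

instance : IsFractionRing (WittVector p (Residue p E)) (MaxUnram p E) :=
  inferInstanceAs (IsFractionRing _ (FractionRing (WittVector p (Residue p E))))

/-- The structure map `ℤ_p = W(𝔽_p) → W(k) → E₀`. -/
def padicIntToMaxUnram : ℤ_[p] →+* MaxUnram p E :=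
  (algebraMap (WittVector p (Residue p E)) (MaxUnram p E)).comp
    ((WittVector.map (algebraMap (ZMod p) (Residue p E))).comp
      (WittVector.equiv p).symm.toRingHom)

lemma padicIntToMaxUnram_injective : Function.Injective (padicIntToMaxUnram p E) :=
  (IsFractionRing.injective _ _).comp
    ((WittVector.map_injective _ (algebraMap (ZMod p) (Residue p E)).injective).comp
      (WittVector.equiv p).symm.injective)

instance : Algebra ℚ_[p] (MaxUnram p E) :=
  (IsFractionRing.lift (A := ℤ_[p]) (K := ℚ_[p]) (padicIntToMaxUnram_injective p E)).toAlgebra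

lemma algebraMap_maxUnram (z : ℤ_[p]) :
    algebraMap ℚ_[p] (MaxUnram p E) (z : ℚ_[p]) = padicIntToMaxUnram p E z :=
  IsFractionRing.lift_algebraMap (padicIntToMaxUnram_injective p E) z

/-- Functoriality of Witt vectors for automorphisms: apply `e` to each component. -/
def wittAut (e : RingAut (Residue p E)) : RingAut (WittVector p (Residue p E)) :=
  RingEquiv.ofRingHom (WittVector.map (e : Residue p E →+* Residue p E))
    (WittVector.map (e.symm : Residue p E →+* Residue p E))
    (by ext x n; simp [WittVector.map_coeff]) (by ext x n; simp [WittVector.map_coeff])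

lemma wittAut_coeff (e : RingAut (Residue p E)) (x : WittVector p (Residue p E)) (n : ℕ) :
    (wittAut p E e x).coeff n = e (x.coeff n) := rfl

lemma wittAut_map (e : RingAut (Residue p E)) (x : WittVector p (ZMod p)) :
    wittAut p E e (WittVector.map (algebraMap (ZMod p) (Residue p E)) x) =
      WittVector.map (algebraMap (ZMod p) (Residue p E)) x := by
  ext n
  rw [wittAut_coeff, WittVector.map_coeff]
  exact congrArg (fun f : ZMod p →+* Residue p E => f (x.coeff n))
    (Subsingleton.elim ((e : Residue p E →+* Residue p E).comp (algebraMap (ZMod p) _)) _)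

/-- The automorphism of `E₀ = Frac W(k)` over `ℚ_p` induced by an automorphism of `k`. -/
def maxUnramAut : RingAut (Residue p E) →* (MaxUnram p E ≃ₐ[ℚ_[p]] MaxUnram p E) where
  toFun e := AlgEquiv.ofRingEquiv
    (f := IsFractionRing.ringEquivOfRingEquiv (K := MaxUnram p E) (L := MaxUnram p E)
      (wittAut p E e))
    (fun r => by
      have : (((IsFractionRing.ringEquivOfRingEquiv (K := MaxUnram p E) (L := MaxUnram p E)
          (wittAut p E e) : MaxUnram p E ≃+* MaxUnram p E) : MaxUnram p E →+* MaxUnram p E).comp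
          (algebraMap ℚ_[p] (MaxUnram p E))) = algebraMap ℚ_[p] (MaxUnram p E) := by
        refine IsLocalization.ringHom_ext (nonZeroDivisors ℤ_[p]) ?_
        ext z
        change IsFractionRing.ringEquivOfRingEquiv (wittAut p E e)
          (algebraMap ℚ_[p] (MaxUnram p E) (z : ℚ_[p])) =
          algebraMap ℚ_[p] (MaxUnram p E) (z : ℚ_[p])
        rw [algebraMap_maxUnram]
        simp only [padicIntToMaxUnram, RingHom.comp_apply,
          IsFractionRing.ringEquivOfRingEquiv_algebraMap, wittAut_map]
      exact congrArg (fun f => f r) this)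
  map_one' := by
    apply AlgEquiv.coe_ringEquiv_injective
    apply RingEquiv.toRingHom_injective
    refine IsLocalization.ringHom_ext (nonZeroDivisors (WittVector p (Residue p E))) ?_
    ext z
    change IsFractionRing.ringEquivOfRingEquiv (wittAut p E 1) (algebraMap _ _ z) = _
    rw [IsFractionRing.ringEquivOfRingEquiv_algebraMap]
    rfl
  map_mul' e₁ e₂ := by
    apply AlgEquiv.coe_ringEquiv_injective
    apply RingEquiv.toRingHom_injective
    refine IsLocalization.ringHom_ext (nonZeroDivisors (WittVector p (Residue p E))) ?_
    ext z
    change IsFractionRing.ringEquivOfRingEquiv (wittAut p E (e₁ * e₂)) (algebraMap _ _ z) =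
      IsFractionRing.ringEquivOfRingEquiv (wittAut p E e₁)
        (IsFractionRing.ringEquivOfRingEquiv (wittAut p E e₂) (algebraMap _ _ z))
    simp only [IsFractionRing.ringEquivOfRingEquiv_algebraMap]
    rfl

/-- The Frobenius of `E₀ = Frac W(k)`: raise each component of the Witt vectors to the `p`. -/
def frob : MaxUnram p E ≃ₐ[ℚ_[p]] MaxUnram p E := maxUnramAut p E (residueFrob p E)

/-- The action on `E₀` of an automorphism of `E`. Restriction of an automorphism to the maximal
unramified subfield corresponds to the action on `Frac W(k)` through the action on `k`. -/
def maxUnramGal : (E ≃ₐ[ℚ_[p]] E) →* (MaxUnram p E ≃ₐ[ℚ_[p]] MaxUnram p E) :=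
  (maxUnramAut p E).comp (residueAut p E)

end Unramified

section Weil

variable {p : ℕ} [Fact p.Prime] (L : IntermediateField ℚ_[p] (PadicAlgCl p))

/-- The homomorphism from `Gal(ℚ̄_p/L)` to the automorphisms of the residue field of `ℚ̄_p`. -/
def galResidue : (PadicAlgCl p ≃ₐ[L] PadicAlgCl p) →* RingAut (Residue p (PadicAlgCl p)) :=
  (residueAut p (PadicAlgCl p)).comp (AlgEquiv.restrictScalarsHom ℚ_[p])

/-- The Weil group `W(ℚ̄_p/L)`: the elements of `Gal(ℚ̄_p/L)` which act on the residue field of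
`ℚ̄_p` through an integral power of the absolute arithmetic Frobenius. -/
def weilGroup : Subgroup (PadicAlgCl p ≃ₐ[L] PadicAlgCl p) :=
  (Subgroup.zpowers (residueFrob p (PadicAlgCl p))).comap (galResidue L)

/-- The inertia group of `L`. -/
def inertia : Subgroup (PadicAlgCl p ≃ₐ[L] PadicAlgCl p) := (galResidue L).ker

lemma residueFrob_pow_apply (E : Type*) [Field E] [Algebra ℚ_[p] E]
    [Algebra.IsAlgebraic ℚ_[p] E] (n : ℕ) (x : Residue p E) :
    (residueFrob p E ^ n) x = x ^ p ^ n := by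
  induction n with
  | zero => simp
  | succ n ih =>
    rw [pow_succ', RingAut.mul_apply, ih, pow_succ, pow_mul]
    rfl

/-- The Frobenius of the residue field of `ℚ̄_p` has infinite order. -/
lemma residueFrob_pow_ne_one {n : ℕ} (hn : n ≠ 0) :
    residueFrob p (PadicAlgCl p) ^ n ≠ 1 := by
  intro h
  have hp := (Fact.out : p.Prime).one_lt
  have hpn : 1 < p ^ n := Nat.one_lt_pow hn hp
  have hdeg : (Polynomial.X ^ p ^ n - (Polynomial.X + Polynomial.C 1) :
      Polynomial (PadicAlgCl p)).degree = (p ^ n : ℕ) := by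
    rw [Polynomial.degree_sub_eq_left_of_degree_lt, Polynomial.degree_X_pow]
    rw [Polynomial.degree_X_pow, Polynomial.degree_X_add_C]
    exact_mod_cast hpn
  obtain ⟨y, hy⟩ := IsAlgClosed.exists_root
    (Polynomial.X ^ p ^ n - (Polynomial.X + Polynomial.C 1) : Polynomial (PadicAlgCl p))
    (by rw [hdeg]; exact_mod_cast (by lia : p ^ n ≠ 0))
  have hy' : y ^ p ^ n = y + 1 := by
    simpa [Polynomial.IsRoot, sub_eq_zero] using hy
  have hint : y ∈ integers p (PadicAlgCl p) := by
    rcases (integers p (PadicAlgCl p)).mem_or_inv_mem y with h1 | h1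
    · exact h1
    by_cases hy0 : y = 0
    · rw [hy0]; exact zero_mem _
    have : y = (y⁻¹) ^ (p ^ n - 2) + (y⁻¹) ^ (p ^ n - 1) := by
      have e1 : p ^ n = (p ^ n - 2) + 2 := by lia
      have e2 : p ^ n - 1 = (p ^ n - 2) + 1 := by lia
      rw [e2]
      rw [e1] at hy'
      generalize p ^ n - 2 = m at hy'
      rw [inv_pow, inv_pow]
      field_simp
      linear_combination y ^ m * hy'
    rw [this]
    exact add_mem (pow_mem h1 _) (pow_mem h1 _)
  let z : integers p (PadicAlgCl p) := ⟨y, hint⟩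
  have hz : z ^ p ^ n = z + 1 := Subtype.ext hy'
  have h2 := congrArg (IsLocalRing.residue _) hz
  rw [map_pow, ← residueFrob_pow_apply, h, map_add, map_one] at h2
  simp at h2

lemma residueFrob_zpow_injective :
    Function.Injective (fun n : ℤ => residueFrob p (PadicAlgCl p) ^ n) := by
  rw [injective_zpow_iff_not_isOfFinOrder, isOfFinOrder_iff_pow_eq_one]
  rintro ⟨n, hn, h⟩
  exact residueFrob_pow_ne_one hn.ne' h

variable {L}

/-- The unique integer `α(w)` such that `w` acts on the residue field of `ℚ̄_p` as the `α(w)`-th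
power of the absolute arithmetic Frobenius. -/
def frobExp (w : weilGroup L) : ℤ := Classical.choose w.2

lemma frobExp_spec (w : weilGroup L) :
    residueFrob p (PadicAlgCl p) ^ frobExp w = galResidue L w := Classical.choose_spec w.2

lemma frobExp_unique (w : weilGroup L) {n : ℤ}
    (h : residueFrob p (PadicAlgCl p) ^ n = galResidue L w) : frobExp w = n :=
  residueFrob_zpow_injective ((frobExp_spec w).trans h.symm)

lemma frobExp_one : frobExp (1 : weilGroup L) = 0 := frobExp_unique _ (by simp)

lemma frobExp_mul (v w : weilGroup L) : frobExp (v * w) = frobExp v + frobExp w :=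
  frobExp_unique _ (by rw [zpow_add, frobExp_spec, frobExp_spec, Subgroup.coe_mul, map_mul])

section Restriction

variable (L' : IntermediateField L (PadicAlgCl p))

instance : Algebra.IsAlgebraic ℚ_[p] L' :=
  Algebra.IsAlgebraic.of_injective (L'.val.restrictScalars ℚ_[p]) L'.val.injective

instance : IsScalarTower ℚ_[p] L' (PadicAlgCl p) := IsScalarTower.of_algebraMap_eq fun _ => rfl

/-- The inclusion of the ring of integers of `L'` into that of `ℚ̄_p`. -/
def integersIncl : integers p L' →+* integers p (PadicAlgCl p) :=
  (L'.val.toRingHom.comp (integers p L').subtype).codRestrict (integers p (PadicAlgCl p)).toSubring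
    (fun x => by
      change spectralNorm ℚ_[p] (PadicAlgCl p) (algebraMap L' (PadicAlgCl p) x) ≤ 1
      rw [← spectralNorm.eq_of_tower]; exact x.2)

instance : IsLocalHom (integersIncl L') := by
  constructor
  intro x hx
  rw [isUnit_integers_iff] at hx ⊢
  rw [← hx]
  exact spectralNorm.eq_of_tower (L := PadicAlgCl p) (x : L')

lemma residueFrob_zpow_map (n : ℤ) (x : Residue p L') :
    IsLocalRing.ResidueField.map (integersIncl L') ((residueFrob p L' ^ n) x) =
      (residueFrob p (PadicAlgCl p) ^ n) (IsLocalRing.ResidueField.map (integersIncl L') x) := by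
  have key : ∀ (m : ℕ) (y : Residue p L'),
      IsLocalRing.ResidueField.map (integersIncl L') ((residueFrob p L' ^ m) y) =
      (residueFrob p (PadicAlgCl p) ^ m) (IsLocalRing.ResidueField.map (integersIncl L') y) := by
    intro m y
    rw [residueFrob_pow_apply, residueFrob_pow_apply, map_pow]
  obtain ⟨m, rfl | rfl⟩ := n.eq_nat_or_neg
  · simpa using key m x
  · apply (residueFrob p (PadicAlgCl p) ^ m).injective
    rw [zpow_neg, zpow_neg, zpow_natCast, zpow_natCast, ← key, ← RingAut.mul_apply,
      ← RingAut.mul_apply, mul_inv_cancel, mul_inv_cancel]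
    rfl

/-- The action of `Gal(L'/L)` on `L'₀`. -/
def galUnram : (L' ≃ₐ[L] L') →* (MaxUnram p L' ≃ₐ[ℚ_[p]] MaxUnram p L') :=
  (maxUnramGal p L').comp (AlgEquiv.restrictScalarsHom ℚ_[p])

variable [Normal L L']

/-- The image `w̄` of an element of the Weil group of `L` in `Gal(L'/L)`. -/
def weilToGal : weilGroup L →* (L' ≃ₐ[L] L') :=
  (AlgEquiv.restrictNormalHom L').comp (weilGroup L).subtype

/-- The image `w̄` acts on `L'₀` as the `α(w)`-th power of the Frobenius. -/
lemma galUnram_weilToGal (w : weilGroup L) :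
    galUnram L' (weilToGal L' w) = frob p L' ^ frobExp w := by
  rw [frob, ← map_zpow, galUnram, maxUnramGal]
  simp only [MonoidHom.comp_apply]
  congr 1
  ext x
  apply (IsLocalRing.ResidueField.map (integersIncl L')).injective
  rw [residueFrob_zpow_map, frobExp_spec]
  obtain ⟨x, rfl⟩ := IsLocalRing.residue_surjective x
  refine congrArg (IsLocalRing.residue (integers p (PadicAlgCl p))) (Subtype.ext ?_)
  exact AlgEquiv.restrictNormal_commutes (w : PadicAlgCl p ≃ₐ[L] PadicAlgCl p) L' (x : L')

end Restriction

end Weil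

open CategoryTheory


section WeilDeligne

variable {p : ℕ} [Fact p.Prime] (L : IntermediateField ℚ_[p] (PadicAlgCl p))
  (K : Type*) [Field K]

/-- A representation `(r, N, V)` of the Weil–Deligne group of `L` over `K`: a finite dimensional
`K`-vector space `V`, a homomorphism `r : W(ℚ̄_p/L) → GL(V)` trivial on an open subgroup of the
inertia group, and a nilpotent endomorphism `N` with `r(w) N r(w)⁻¹ = ‖w‖ N`, where
`‖w‖ = p ^ α(w)`, i.e. `w` acts as `x ↦ x ^ ‖w‖` on the residue field. -/
structure WeilDeligneRep where
  carrier : Type w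
  [addCommGroup : AddCommGroup carrier]
  [module : Module K carrier]
  [finite : FiniteDimensional K carrier]
  r : Representation K (weilGroup L) carrier
  smooth : ∃ U : Subgroup (PadicAlgCl p ≃ₐ[L] PadicAlgCl p),
    IsOpen (U : Set (PadicAlgCl p ≃ₐ[L] PadicAlgCl p)) ∧
      ∀ w : weilGroup L, (w : PadicAlgCl p ≃ₐ[L] PadicAlgCl p) ∈ inertia L ⊓ U → r w = 1
  N : carrier →ₗ[K] carrier
  nilpotent : IsNilpotent N
  r_N : ∀ (w : weilGroup L) (v : carrier),
    r w (N v) = (p : K) ^ frobExp w • N (r w v)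

attribute [instance] WeilDeligneRep.addCommGroup WeilDeligneRep.module WeilDeligneRep.finite

namespace WeilDeligneRep

variable {L K}

/-- Morphisms: `K`-linear maps commuting with the Weil group and with `N`. -/
@[ext]
structure Hom (V W : WeilDeligneRep.{w} L K) where
  toLinearMap : V.carrier →ₗ[K] W.carrier
  r_comm : ∀ w v, toLinearMap (V.r w v) = W.r w (toLinearMap v)
  N_comm : ∀ v, toLinearMap (V.N v) = W.N (toLinearMap v)

instance : Category (WeilDeligneRep.{w} L K) where
  Hom := Hom
  id V := ⟨LinearMap.id, fun _ _ => rfl, fun _ => rfl⟩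
  comp f g := ⟨g.toLinearMap ∘ₗ f.toLinearMap,
    fun w v => by simp [f.r_comm, g.r_comm], fun v => by simp [f.N_comm, g.N_comm]⟩

/-- `r` is unramified when restricted to `W(ℚ̄_p/L')`: it is trivial on the inertia group of
`L'`. -/
def IsUnramifiedOver (L' : IntermediateField L (PadicAlgCl p)) :
    ObjectProperty (WeilDeligneRep.{w} L K) := fun V =>
  ∀ w : weilGroup L, (w : PadicAlgCl p ≃ₐ[L] PadicAlgCl p) ∈ L'.fixingSubgroup →
    (w : PadicAlgCl p ≃ₐ[L] PadicAlgCl p) ∈ inertia L → V.r w = 1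

end WeilDeligneRep

end WeilDeligne

section Mod

variable {p : ℕ} [Fact p.Prime] {L : IntermediateField ℚ_[p] (PadicAlgCl p)}
  (L' : IntermediateField L (PadicAlgCl p)) (K : Type*) [Field K] [Algebra ℚ_[p] K]

/-- A `(φ, N, Gal(L'/L))`-module over `L'₀ ⊗_{ℚ_p} K`: a free module of finite rank with a
bijective Frobenius-semilinear `φ`, a linear `N` such that `N φ = p φ N`, and a semilinear action
of `Gal(L'/L)` commuting with `φ` and `N`. -/
structure PhiNGalMod where
  carrier : Type w
  [addCommGroup : AddCommGroup carrier]
  [module : Module (MaxUnram p L' ⊗[ℚ_[p]] K) carrier]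
  [free : Module.Free (MaxUnram p L' ⊗[ℚ_[p]] K) carrier]
  [finite : Module.Finite (MaxUnram p L' ⊗[ℚ_[p]] K) carrier]
  φ : carrier ≃+ carrier
  φ_smul : ∀ (l : MaxUnram p L') (k : K) (d : carrier),
    φ ((l ⊗ₜ[ℚ_[p]] k) • d) = (frob p L' l ⊗ₜ[ℚ_[p]] k) • φ d
  N : carrier →ₗ[MaxUnram p L' ⊗[ℚ_[p]] K] carrier
  N_φ : ∀ d, N (φ d) = p • φ (N d)
  gal : (L' ≃ₐ[L] L') →* AddMonoid.End carrier
  gal_smul : ∀ (g : L' ≃ₐ[L] L') (l : MaxUnram p L') (k : K) (d : carrier),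
    gal g ((l ⊗ₜ[ℚ_[p]] k) • d) = (galUnram L' g l ⊗ₜ[ℚ_[p]] k) • gal g d
  gal_φ : ∀ g d, gal g (φ d) = φ (gal g d)
  gal_N : ∀ g d, gal g (N d) = N (gal g d)

attribute [instance] PhiNGalMod.addCommGroup PhiNGalMod.module PhiNGalMod.free PhiNGalMod.finite

namespace PhiNGalMod

variable {L' K}

/-- Morphisms: linear maps commuting with `φ`, with `N` and with `Gal(L'/L)`. -/
@[ext]
structure Hom (D D' : PhiNGalMod.{w} L' K) where
  toLinearMap : D.carrier →ₗ[MaxUnram p L' ⊗[ℚ_[p]] K] D'.carrier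
  φ_comm : ∀ d, toLinearMap (D.φ d) = D'.φ (toLinearMap d)
  N_comm : ∀ d, toLinearMap (D.N d) = D'.N (toLinearMap d)
  gal_comm : ∀ g d, toLinearMap (D.gal g d) = D'.gal g (toLinearMap d)

instance : Category (PhiNGalMod.{w} L' K) where
  Hom := Hom
  id D := ⟨LinearMap.id, fun _ => rfl, fun _ => rfl, fun _ _ => rfl⟩
  comp f g := ⟨g.toLinearMap ∘ₗ f.toLinearMap, fun d => by simp [f.φ_comm, g.φ_comm],
    fun d => by simp [f.N_comm, g.N_comm], fun h d => by simp [f.gal_comm, g.gal_comm]⟩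

variable (D : PhiNGalMod.{w} L' K)

/-- The underlying `K`-vector space structure. -/
instance : Module K D.carrier :=
  Module.compHom D.carrier
    (Algebra.TensorProduct.includeRight : K →ₐ[ℚ_[p]] MaxUnram p L' ⊗[ℚ_[p]] K).toRingHom

lemma smul_def (k : K) (d : D.carrier) : k • d = ((1 : MaxUnram p L') ⊗ₜ[ℚ_[p]] k) • d := rfl

/-- `φ` as a `K`-linear automorphism. -/
def φK : D.carrier ≃ₗ[K] D.carrier :=
  { D.φ with map_smul' := fun k d => by simp [smul_def, D.φ_smul] }

/-- `N` as a `K`-linear endomorphism. -/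
def NK : D.carrier →ₗ[K] D.carrier :=
  { D.N with map_smul' := fun k d => by simp [smul_def] }

/-- The action of `Gal(L'/L)` through `K`-linear endomorphisms. -/
def galK : Representation K (L' ≃ₐ[L] L') D.carrier where
  toFun g :=
    { toFun := D.gal g
      map_add' := map_add _
      map_smul' := fun k d => by
        simpa [smul_def] using D.gal_smul g 1 k d }
  map_one' := by
    ext d
    change D.gal 1 d = d
    rw [map_one]; rfl
  map_mul' g h := by
    ext d
    change D.gal (g * h) d = D.gal g (D.gal h d)
    rw [map_mul]; rfl

lemma φK_apply (d : D.carrier) : D.φK d = D.φ d := rfl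
lemma NK_apply (d : D.carrier) : D.NK d = D.N d := rfl
lemma galK_apply (g : L' ≃ₐ[L] L') (d : D.carrier) : D.galK g d = D.gal g d := rfl

lemma φK_zpow_smul (n : ℤ) (l : MaxUnram p L') (k : K) (d : D.carrier) :
    (D.φK ^ n) ((l ⊗ₜ[ℚ_[p]] k) • d) = ((frob p L' ^ n) l ⊗ₜ[ℚ_[p]] k) • (D.φK ^ n) d := by
  induction n generalizing l d with
  | zero => simp
  | succ n ih =>
    rw [zpow_add_one, zpow_add_one, LinearEquiv.mul_apply, LinearEquiv.mul_apply,
      AlgEquiv.mul_apply, φK_apply, D.φ_smul, ih, ← φK_apply]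
  | pred n ih =>
    obtain ⟨l, rfl⟩ := (frob p L').surjective l
    obtain ⟨d, rfl⟩ := D.φK.surjective d
    rw [φK_apply, ← D.φ_smul, ← φK_apply, ← φK_apply, ← LinearEquiv.mul_apply,
      ← LinearEquiv.mul_apply, ← AlgEquiv.mul_apply, ← zpow_add_one, ← zpow_add_one]
    simpa using ih l d

lemma φK_zpow_gal (n : ℤ) (g : L' ≃ₐ[L] L') (d : D.carrier) :
    D.galK g ((D.φK ^ n) d) = (D.φK ^ n) (D.galK g d) := by
  induction n generalizing d with
  | zero => simp
  | succ n ih =>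
    rw [zpow_add_one, LinearEquiv.mul_apply, LinearEquiv.mul_apply, ih, φK_apply, galK_apply,
      D.gal_φ]
    rfl
  | pred n ih =>
    obtain ⟨d, rfl⟩ := D.φK.surjective d
    have h : D.galK g (D.φK d) = D.φK (D.galK g d) := D.gal_φ g d
    rw [h, ← LinearEquiv.mul_apply, ← LinearEquiv.mul_apply, ← zpow_add_one]
    simpa using ih d

lemma natCast_ne_zero_of_algebra : (p : K) ≠ 0 := by
  rw [← map_natCast (algebraMap ℚ_[p] K)]
  exact (map_ne_zero _).2 (Nat.cast_ne_zero.2 (Fact.out : p.Prime).ne_zero)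

lemma NK_φK (d : D.carrier) : D.NK (D.φK d) = (p : K) • D.φK (D.NK d) := by
  rw [Nat.cast_smul_eq_nsmul]
  exact D.N_φ d

lemma φK_zpow_N (n : ℤ) (d : D.carrier) :
    (D.φK ^ (-n)) (D.NK d) = (p : K) ^ n • D.NK ((D.φK ^ (-n)) d) := by
  have hp : (p : K) ≠ 0 := natCast_ne_zero_of_algebra
  have key : ∀ (m : ℤ) (e : D.carrier),
      D.NK ((D.φK ^ m) e) = (p : K) ^ m • (D.φK ^ m) (D.NK e) := by
    intro m
    induction m with
    | zero => simp
    | succ m ih =>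
      intro e
      rw [zpow_add_one, LinearEquiv.mul_apply, ih, NK_φK, map_smul, smul_smul,
        LinearEquiv.mul_apply, zpow_add_one₀ hp]
    | pred m ih =>
      intro e
      obtain ⟨e, rfl⟩ := D.φK.surjective e
      rw [NK_φK, map_smul, smul_smul, ← zpow_add_one₀ hp, ← LinearEquiv.mul_apply,
        ← LinearEquiv.mul_apply, ← zpow_add_one]
      simpa using ih e
  rw [key, smul_smul, ← zpow_add₀ hp]
  simp

section Weil

variable [Normal L L']

/-- The operator `r(w) = w̄ ∘ φ^{-α(w)}` on `D`. -/
def weilEnd : Representation K (weilGroup L) D.carrier where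
  toFun w := D.galK (weilToGal L' w) ∘ₗ (D.φK ^ (-frobExp w)).toLinearMap
  map_one' := by
    ext d
    simp [frobExp_one]
  map_mul' v w := by
    ext d
    simp only [frobExp_mul, map_mul, LinearMap.comp_apply, Module.End.mul_apply,
      LinearEquiv.coe_coe, neg_add, zpow_add, LinearEquiv.mul_apply, φK_zpow_gal]

lemma weilEnd_apply (w : weilGroup L) (d : D.carrier) :
    D.weilEnd w d = D.galK (weilToGal L' w) ((D.φK ^ (-frobExp w)) d) := rfl

/-- The operators `r(w)` are linear over `L'₀ ⊗ K`. -/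
lemma weilEnd_smul (w : weilGroup L) (l : MaxUnram p L') (k : K) (d : D.carrier) :
    D.weilEnd w ((l ⊗ₜ[ℚ_[p]] k) • d) = (l ⊗ₜ[ℚ_[p]] k) • D.weilEnd w d := by
  rw [weilEnd_apply, φK_zpow_smul, galK_apply, D.gal_smul, galUnram_weilToGal,
    ← AlgEquiv.mul_apply, ← zpow_add]
  simp [weilEnd_apply, galK_apply]

variable {D} in
lemma weilEnd_of_mem (w : weilGroup L)
    (hw : (w : PadicAlgCl p ≃ₐ[L] PadicAlgCl p) ∈ L'.fixingSubgroup)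
    (hi : (w : PadicAlgCl p ≃ₐ[L] PadicAlgCl p) ∈ inertia L) (d : D.carrier) :
    D.weilEnd w d = d := by
  have h1 : frobExp w = 0 := frobExp_unique w (by rw [zpow_zero]; exact hi.symm)
  have h2 : weilToGal L' w = 1 := by
    ext x
    exact (AlgEquiv.restrictNormal_commutes (w : PadicAlgCl p ≃ₐ[L] PadicAlgCl p) L' x).trans
      (hw x)
  rw [weilEnd_apply, h1, h2]
  simp

lemma weilEnd_N (w : weilGroup L) (d : D.carrier) :
    D.weilEnd w (D.NK d) = (p : K) ^ frobExp w • D.NK (D.weilEnd w d) := by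
  rw [weilEnd_apply, φK_zpow_N, map_smul, weilEnd_apply]
  congr 1
  exact D.gal_N _ _

end Weil

variable (σ₀ : MaxUnram p L' →ₐ[ℚ_[p]] K)

/-- The component `D_{σ₀}` of `D ≃ ∏_σ D_σ`, where `σ` runs through the embeddings `L'₀ → K`: the
part of `D` on which `L'₀` acts through `σ₀`. -/
def component : Submodule K D.carrier where
  carrier := {d | ∀ l : MaxUnram p L', (l ⊗ₜ[ℚ_[p]] (1 : K)) • d = σ₀ l • d}
  add_mem' {x y} hx hy l := by rw [smul_add, smul_add, hx l, hy l]
  zero_mem' l := by simp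
  smul_mem' k x hx l := by
    rw [smul_comm (σ₀ l) k x, ← hx l, smul_def, smul_def, smul_smul, smul_smul, mul_comm]

lemma mem_component {d : D.carrier} :
    d ∈ D.component σ₀ ↔ ∀ l : MaxUnram p L', (l ⊗ₜ[ℚ_[p]] (1 : K)) • d = σ₀ l • d := Iff.rfl

lemma finite_over (D : PhiNGalMod.{w} L' K) (σ₀ : MaxUnram p L' →ₐ[ℚ_[p]] K)
    [FiniteDimensional ℚ_[p] K] : FiniteDimensional K D.carrier := by
  have : FiniteDimensional ℚ_[p] (MaxUnram p L') :=
    FiniteDimensional.of_injective σ₀.toLinearMap σ₀.injective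
  let : Algebra K (MaxUnram p L' ⊗[ℚ_[p]] K) := Algebra.TensorProduct.rightAlgebra
  have : Module.Finite K (MaxUnram p L' ⊗[ℚ_[p]] K) := by
    let e : (K ⊗[ℚ_[p]] MaxUnram p L') ≃ₗ[K] (MaxUnram p L' ⊗[ℚ_[p]] K) :=
      { (Algebra.TensorProduct.comm ℚ_[p] K (MaxUnram p L')).toRingEquiv.toAddEquiv with
        map_smul' := fun k x => by
          change Algebra.TensorProduct.comm ℚ_[p] K (MaxUnram p L') (k • x) =
            k • Algebra.TensorProduct.comm ℚ_[p] K (MaxUnram p L') x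
          rw [Algebra.smul_def, Algebra.smul_def, map_mul]
          rfl }
    exact Module.Finite.equiv e
  have : IsScalarTower K (MaxUnram p L' ⊗[ℚ_[p]] K) D.carrier :=
    ⟨fun k x d => by rw [Algebra.smul_def, mul_smul]; rfl⟩
  exact Module.Finite.trans (MaxUnram p L' ⊗[ℚ_[p]] K) D.carrier

/-- `N` is automatically nilpotent. -/
lemma NK_nilpotent [FiniteDimensional K D.carrier] : IsNilpotent D.NK := by
  by_contra hN
  rw [IsNilpotent, not_exists] at hN
  have hp : (p : K) ≠ 0 := natCast_ne_zero_of_algebra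
  have : CharZero K := charZero_of_injective_algebraMap (algebraMap ℚ_[p] K).injective
  have key : ∀ (i : ℕ) (d : D.carrier),
      (D.NK ^ i) (D.φK d) = (p : K) ^ i • D.φK ((D.NK ^ i) d) := by
    intro i
    induction i with
    | zero => simp
    | succ i ih =>
      intro d
      rw [pow_succ', Module.End.mul_apply, ih, map_smul, NK_φK, smul_smul, pow_succ,
        Module.End.mul_apply]
  have hinj : Function.Injective (fun i : ℕ => (p : K) ^ i) := by
    intro i j h
    have h' : p ^ i = p ^ j := by
      simp only at h
      exact_mod_cast h
    exact Nat.pow_right_injective (Fact.out : p.Prime).two_le h'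
  have hlin := Module.End.eigenvectors_linearIndependent'
    (D.φK.symm.conj : Module.End K (Module.End K D.carrier)) _ hinj (fun i => D.NK ^ i)
    (fun i => ⟨by
      rw [Module.End.mem_eigenspace_iff]
      ext d
      simp [LinearEquiv.conj_apply, key], hN i⟩)
  exact not_finite_iff_infinite.2 inferInstance hlin.finite

variable {D} in
lemma N_mem {d : D.carrier} (hd : d ∈ D.component σ₀) : D.NK d ∈ D.component σ₀ := by
  intro l
  exact (D.N.map_smul _ _).symm.trans ((congrArg D.NK (hd l)).trans (D.NK.map_smul _ _))

variable {D} in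
lemma weilEnd_mem [Normal L L'] (w : weilGroup L) {d : D.carrier}
    (hd : d ∈ D.component σ₀) : D.weilEnd w d ∈ D.component σ₀ := by
  intro l
  rw [← weilEnd_smul, hd l, map_smul]

variable {D} in
lemma hom_φK_zpow {D' : PhiNGalMod.{w} L' K} (f : Hom D D') (n : ℤ) (d : D.carrier) :
    f.toLinearMap ((D.φK ^ n) d) = (D'.φK ^ n) (f.toLinearMap d) := by
  induction n generalizing d with
  | zero => simp
  | succ n ih =>
    rw [zpow_add_one, zpow_add_one, LinearEquiv.mul_apply, LinearEquiv.mul_apply, ih, φK_apply,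
      f.φ_comm]
    rfl
  | pred n ih =>
    obtain ⟨d, rfl⟩ := D.φK.surjective d
    have h : f.toLinearMap (D.φK d) = D'.φK (f.toLinearMap d) := f.φ_comm d
    rw [h, ← LinearEquiv.mul_apply, ← LinearEquiv.mul_apply, ← zpow_add_one, ← zpow_add_one]
    simpa using ih d

variable {D} in
lemma hom_weilEnd [Normal L L'] {D' : PhiNGalMod.{w} L' K} (f : Hom D D') (v : weilGroup L)
    (d : D.carrier) : f.toLinearMap (D.weilEnd v d) = D'.weilEnd v (f.toLinearMap d) := by
  rw [weilEnd_apply, weilEnd_apply, ← hom_φK_zpow]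
  exact f.gal_comm _ _

/-- The map induced by a morphism on the components `D_{σ₀}`. -/
def Hom.component {D D' : PhiNGalMod.{w} L' K} (f : Hom D D') :
    D.component σ₀ →ₗ[K] D'.component σ₀ where
  toFun d := ⟨f.toLinearMap d, fun l => by
    have h := congrArg f.toLinearMap (d.2 l)
    rw [map_smul, smul_def, map_smul] at h
    exact h⟩
  map_add' x y := Subtype.ext (map_add f.toLinearMap _ _)
  map_smul' k x := Subtype.ext (f.toLinearMap.map_smul _ _)

variable [FiniteDimensional ℚ_[p] K] [FiniteDimensional L L'] [Normal L L']

/-- The Weil–Deligne representation `(r, N, D_{σ₀})` attached to `D`, where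
`r(w) = w̄ ∘ φ^{-α(w)}`. -/
def toWD : WeilDeligneRep.{w} L K where
  carrier := D.component σ₀
  finite :=
    have := finite_over D σ₀
    inferInstance
  r :=
    { toFun := fun w => (D.weilEnd w).restrict fun _ hd => weilEnd_mem σ₀ w hd
      map_one' := by ext; simp
      map_mul' := fun v w => by ext; simp }
  smooth := by
    refine ⟨L'.fixingSubgroup, L'.fixingSubgroup_isOpen, fun w hw => ?_⟩
    ext d
    exact weilEnd_of_mem w hw.2 hw.1 (d : D.carrier)
  N := D.NK.restrict fun _ hd => N_mem σ₀ hd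
  nilpotent := by
    have := finite_over D σ₀
    obtain ⟨n, hn⟩ := D.NK_nilpotent
    refine ⟨n, ?_⟩
    rw [Module.End.pow_restrict]
    ext d
    simp [hn]
  r_N w v := Subtype.ext (D.weilEnd_N w v)

end PhiNGalMod

/-- Fontaine's functor from `(φ, N, Gal(L'/L))`-modules to representations of the Weil–Deligne
group of `L` that are unramified on `W(ℚ̄_p/L')`, formed with the embedding `σ₀ : L'₀ → K`. -/
def WD [FiniteDimensional ℚ_[p] K] [FiniteDimensional L L'] [Normal L L']
    (σ₀ : MaxUnram p L' →ₐ[ℚ_[p]] K) :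
    PhiNGalMod.{w} L' K ⥤
      (WeilDeligneRep.IsUnramifiedOver (K := K) L').FullSubcategory :=
  ObjectProperty.lift _
    { obj := fun D => D.toWD σ₀
      map := fun f =>
        { toLinearMap := PhiNGalMod.Hom.component σ₀ f
          r_comm := fun w v => Subtype.ext (PhiNGalMod.hom_weilEnd f w v.1)
          N_comm := fun v => Subtype.ext (f.N_comm v.1) }
      map_id := fun _ => rfl
      map_comp := fun _ _ => rfl }
    (fun D w hw hi => by
      refine LinearMap.ext fun d : D.component σ₀ => Subtype.ext ?_
      exact PhiNGalMod.weilEnd_of_mem w hw hi (d : D.carrier))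

end Mod

end FontaineWD

end

noncomputable section

namespace FontaineWD

/-! ### The Galois group of `E₀` over `ℚ_p` is generated by the Frobenius. -/

section Frobenius

variable (p : ℕ) [Fact p.Prime] (E : Type*) [Field E] [Algebra ℚ_[p] E]
  [Algebra.IsAlgebraic ℚ_[p] E]

/-! Write f = [L'₀ : ℚ_p], which is finite because σ₀ embeds L'₀ in K. The fixed field of the
Frobenius φ₀ of L'₀ is ℚ_p, so L'₀/ℚ_p is Galois with cyclic group of order f generated by φ₀
(`zpowers_frob`). The ℚ_p-embeddings of L'₀ in K are therefore σ₀ ∘ φ₀⁻ⁿ for n mod f, and orthogonal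
idempotents split L'₀ ⊗ K into f copies of K. Accordingly D is the direct sum of components D_n, and
φⁿ identifies D_0 = D_{σ₀} with D_n.

So D can be recovered from D_0 as soon as φ^f on D_0 and the Galois action are known. The Weil group
supplies both. Its image in Gal(L'/L) × ℤ under (w̄, α(w)) consists exactly of the pairs (g, n) such
that g acts on L'₀ as φ₀ⁿ (`exists_weilToGal_eq_and_frobExp_eq`). Taking (1, -f) gives an element
with r(w) = φ^f. Every g lifts to some w, and then g = r(w) φ^{α(w)}.

Faithfulness: a morphism commutes with φ, so its values on D_n are determined by those on D_0.
Fullness: extend h on D_0 by φⁿ h φ⁻ⁿ on D_n. This depends only on n mod f because h commutes with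
r(w) = φ^f, so the extension commutes with φ, and then with Gal(L'/L) (`homOfComponent`).

Essential surjectivity: from V form the functions F : ℤ → V with r(s) F(n) = F(n + α(s)) for all s
in the Weil group of L', where L'₀ acts on the value at n through σ₀ ∘ φ₀⁻ⁿ and φ is the shift. Such
F is freely determined by its values on 0, …, f - 1, so the module is free. Its σ₀-component
consists of the functions supported on fℤ, and evaluation at 0 identifies it with V (`evalZero`). -/

lemma maxUnramAut_algebraMap (e : RingAut (Residue p E)) (x : WittVector p (Residue p E)) :
    maxUnramAut p E e (algebraMap _ (MaxUnram p E) x) = algebraMap _ _ (wittAut p E e x) :=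
  IsFractionRing.ringEquivOfRingEquiv_algebraMap (wittAut p E e) x

/-- The zeroth component of a Teichmüller representative recovers the residue class. This allows an
action on `E₀` to be read off on the residue field. -/
lemma maxUnramAut_injective : Function.Injective (maxUnramAut p E) := by
  intro e₁ e₂ h
  ext x
  have h1 := DFunLike.congr_fun h
    (algebraMap (WittVector p (Residue p E)) (MaxUnram p E) (WittVector.teichmuller p x))
  rw [maxUnramAut_algebraMap, maxUnramAut_algebraMap] at h1
  have h2 := congrArg (fun z => WittVector.coeff z 0)
    (IsFractionRing.injective (WittVector p (Residue p E)) (MaxUnram p E) h1)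
  simpa only [wittAut_coeff, WittVector.teichmuller_coeff_zero] using h2

lemma exists_algebraMap_residue_eq {y : Residue p E} (hy : y ^ p = y) :
    ∃ z, algebraMap (ZMod p) (Residue p E) z = y := by
  obtain ⟨n, rfl⟩ := (mem_bot_iff_intCast p _).1
    ((Subfield.mem_bot_iff_pow_eq_self _ p).2 hy)
  exact ⟨n, map_intCast _ n⟩

/-- The elements of `E₀` fixed by the Frobenius are those of `ℚ_p`. -/
lemma exists_algebraMap_eq_of_frob_eq {x : MaxUnram p E} (hx : frob p E x = x) :
    ∃ z, algebraMap ℚ_[p] (MaxUnram p E) z = x := by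
  obtain ⟨a, b, hb, rfl⟩ := IsFractionRing.div_surjective (A := WittVector p (Residue p E)) x
  have hb0 : b ≠ 0 := nonZeroDivisors.ne_zero hb
  -- Every nonzero denominator is a power of p times a unit, so x = c / p ^ m with c a Witt vector.
  -- As p is fixed by the Frobenius, so is c. Each component of c is then a root of y ^ p = y, hence
  -- lies in 𝔽_p, and c comes from W(𝔽_p) = ℤ_p.
  obtain ⟨m, u, rfl⟩ := WittVector.exists_eq_pow_p_mul' b hb0
  have hp0 : algebraMap (WittVector p (Residue p E)) (MaxUnram p E) ((p : WittVector p (Residue p E)) ^ m) ≠ 0 := by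
    rw [Ne, map_eq_zero_iff _ (IsFractionRing.injective _ _)]
    exact left_ne_zero_of_mul hb0
  have hu : algebraMap (WittVector p (Residue p E)) (MaxUnram p E) u ≠ 0 := by
    rw [Ne, map_eq_zero_iff _ (IsFractionRing.injective _ _)]
    exact u.ne_zero
  obtain ⟨c, rfl⟩ : ∃ c, a = c * u := ⟨a * (u⁻¹ : (WittVector p (Residue p E))ˣ), by
    rw [mul_assoc, Units.inv_mul, mul_one]⟩
  have hxc : algebraMap _ (MaxUnram p E) (c * u) / algebraMap _ (MaxUnram p E)
      ((p : WittVector p (Residue p E)) ^ m * (u : WittVector p (Residue p E))) =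
        algebraMap _ (MaxUnram p E) c / (p : MaxUnram p E) ^ m := by
    rw [map_mul, map_mul, mul_div_mul_right _ _ hu, map_pow, map_natCast]
  rw [hxc] at hx ⊢
  have hpm : (p : MaxUnram p E) ^ m ≠ 0 := by simpa using hp0
  rw [map_div₀, map_pow, map_natCast, div_left_inj' hpm, frob, maxUnramAut_algebraMap] at hx
  have hcw := IsFractionRing.injective (WittVector p (Residue p E)) (MaxUnram p E) hx
  have hcoeff : ∀ n, ∃ z, algebraMap (ZMod p) (Residue p E) z = c.coeff n := fun n =>
    exists_algebraMap_residue_eq p E (congrArg (fun z => WittVector.coeff z n) hcw)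
  choose z hz using hcoeff
  refine ⟨((WittVector.equiv p (WittVector.mk p z) : ℤ_[p]) : ℚ_[p]) / p ^ m, ?_⟩
  rw [map_div₀, algebraMap_maxUnram, map_pow, map_natCast]
  congr 1
  have : c = WittVector.map (algebraMap (ZMod p) (Residue p E)) (WittVector.mk p z) := by
    ext n
    rw [WittVector.map_coeff, WittVector.coeff_mk, hz]
  rw [this]
  simp [padicIntToMaxUnram]

variable [FiniteDimensional ℚ_[p] (MaxUnram p E)]

omit [FiniteDimensional ℚ_[p] (MaxUnram p E)] in
lemma fixedField_zpowers_frob :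
    IntermediateField.fixedField (Subgroup.zpowers (frob p E)) = ⊥ := by
  refine eq_bot_iff.2 fun x hx => ?_
  rw [IntermediateField.mem_bot]
  exact exists_algebraMap_eq_of_frob_eq p E
    (hx ⟨frob p E, Subgroup.mem_zpowers _⟩)

instance : IsGalois ℚ_[p] (MaxUnram p E) := by
  refine IsGalois.of_fixedField_eq_bot _ _ (eq_bot_iff.2 ?_)
  rw [← fixedField_zpowers_frob]
  exact fun x hx g => hx ⟨g.1, trivial⟩

/-- By the Galois correspondence, a subgroup whose fixed field is the base field is the whole group.
-/
lemma zpowers_frob : Subgroup.zpowers (frob p E) = ⊤ := by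
  rw [← IntermediateField.fixingSubgroup_fixedField (Subgroup.zpowers (frob p E)),
    fixedField_zpowers_frob, IntermediateField.fixingSubgroup_bot]

lemma orderOf_frob : orderOf (frob p E) = Module.finrank ℚ_[p] (MaxUnram p E) := by
  rw [orderOf_eq_card_of_zpowers_eq_top (zpowers_frob p E), IsGalois.card_aut_eq_finrank]

lemma exists_frob_zpow_eq (g : MaxUnram p E ≃ₐ[ℚ_[p]] MaxUnram p E) :
    ∃ n : ℤ, frob p E ^ n = g :=
  Subgroup.mem_zpowers_iff.1 (zpowers_frob p E ▸ Subgroup.mem_top g)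

end Frobenius

/-! ### The image of the Weil group in Gal(L'/L) × ℤ. -/

section Lift

variable {p : ℕ} [Fact p.Prime] {L : IntermediateField ℚ_[p] (PadicAlgCl p)}
  (L' : IntermediateField L (PadicAlgCl p))

/-- `Gal(ℚ̄_p/L')` surjects onto the automorphisms of the residue field of `ℚ̄_p` over that
of `L'`. -/
lemma exists_residueAut_eq (τ : RingAut (Residue p (PadicAlgCl p)))
    (hτ : ∀ x : Residue p L', τ (IsLocalRing.ResidueField.map (integersIncl L') x) =
      IsLocalRing.ResidueField.map (integersIncl L') x) :
    ∃ s : PadicAlgCl p ≃ₐ[L] PadicAlgCl p, s ∈ L'.fixingSubgroup ∧ galResidue L s = τ := by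
  let A := integers p L'
  let B := integers p (PadicAlgCl p)
  let G := PadicAlgCl p ≃ₐ[L'] PadicAlgCl p
  let : Algebra A B := (integersIncl L').toAlgebra
  let : MulSemiringAction G B := MulSemiringAction.compHom B
    ((integersAut p (E := PadicAlgCl p)).comp (AlgEquiv.restrictScalarsHom ℚ_[p] : G →* _))
  have hsmul : ∀ (g : G) (b : B), ((g • b : B) : PadicAlgCl p) = g (b : PadicAlgCl p) :=
    fun _ _ => rfl
  have : SMulCommClass G A B := ⟨fun g a b => by
    rw [Algebra.smul_def, Algebra.smul_def, smul_mul']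
    congr 1
    exact Subtype.ext (g.commutes (a : L'))⟩
  -- For the discrete topology, continuity of the action means that stabilizers are open, which
  -- holds because every element is algebraic over `L'`. The ring of invariants is `A` by infinite
  -- Galois theory, so the decomposition group surjects onto the automorphisms of the residue
  -- extension.
  let : TopologicalSpace B := ⊥
  have : DiscreteTopology B := ⟨rfl⟩
  have : Algebra.IsAlgebraic L' (PadicAlgCl p) := Algebra.IsAlgebraic.tower_top (K := ℚ_[p]) L'
  have : IsGalois L' (PadicAlgCl p) := IsGalois.tower_top_of_isGalois ℚ_[p] L' (PadicAlgCl p)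
  have : ContinuousSMul G B := by
    rw [continuousSMul_iff_stabilizer_isOpen]
    intro b
    convert stabilizer_isOpen_of_isIntegral (K := L') (b : PadicAlgCl p) using 1
    ext g
    exact Subtype.ext_iff
  have : Algebra.IsInvariant A B G := ⟨fun b hb => by
    obtain ⟨a, ha⟩ := (InfiniteGalois.mem_range_algebraMap_iff_fixed (k := L') (b : PadicAlgCl p)).2
      fun g => congrArg Subtype.val (hb g)
    have ha' : a ∈ integers p L' := by
      rw [mem_integers, spectralNorm.eq_of_tower (L := PadicAlgCl p), ha]
      exact b.2
    exact ⟨⟨a, ha'⟩, Subtype.ext ha⟩⟩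
  let P := IsLocalRing.maximalIdeal A
  let Q := IsLocalRing.maximalIdeal B
  have : Q.LiesOver P := ⟨(IsLocalRing.maximalIdeal_comap (integersIncl L')).symm⟩
  let τ' : (B ⧸ Q) ≃ₐ[A ⧸ P] (B ⧸ Q) := AlgEquiv.ofRingEquiv (f := τ) (fun x => by
    have := hτ x
    obtain ⟨x, rfl⟩ := Ideal.Quotient.mk_surjective x
    exact this)
  obtain ⟨⟨s, hs⟩, hsτ⟩ := Ideal.Quotient.stabilizerHom_surjective_of_profinite P Q (G := G) τ'
  refine ⟨s.restrictScalars L, fun x => s.commutes x, ?_⟩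
  ext x
  obtain ⟨x, rfl⟩ := IsLocalRing.residue_surjective x
  exact DFunLike.congr_fun hsτ (Ideal.Quotient.mk Q x)

variable [Normal L L']

/-- The image of the Weil group in `Gal(L'/L) × ℤ` consists of the pairs `(g, n)` for which `g`
acts on `L'₀` as the `n`-th power of the Frobenius. -/
lemma exists_weilToGal_eq_and_frobExp_eq {g : L' ≃ₐ[L] L'} {n : ℤ}
    (h : galUnram L' g = frob p L' ^ n) :
    ∃ w : weilGroup L, weilToGal L' w = g ∧ frobExp w = n := by
  have : Algebra.IsAlgebraic L (PadicAlgCl p) := Algebra.IsAlgebraic.tower_top (K := ℚ_[p]) L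
  have : Normal L (PadicAlgCl p) := Normal.tower_top_of_normal ℚ_[p] L (PadicAlgCl p)
  -- An arbitrary lift of g acts as the n-th power of the Frobenius on the residue field of `L'`,
  -- but perhaps not on that of `ℚ̄_p`.
  obtain ⟨g', hg'⟩ := AlgEquiv.restrictNormalHom_surjective (F := L) (K₁ := L') (E := PadicAlgCl p) g
  have hres : residueAut p L' (AlgEquiv.restrictScalarsHom ℚ_[p] g) = residueFrob p L' ^ n := by
    apply maxUnramAut_injective
    rw [map_zpow]
    exact h
  have hg'res : ∀ x : Residue p L',
      galResidue L g' (IsLocalRing.ResidueField.map (integersIncl L') x) =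
        (residueFrob p (PadicAlgCl p) ^ n) (IsLocalRing.ResidueField.map (integersIncl L') x) := by
    intro x
    rw [← residueFrob_zpow_map, ← hres, ← hg']
    obtain ⟨x, rfl⟩ := IsLocalRing.residue_surjective x
    refine congrArg (IsLocalRing.residue (integers p (PadicAlgCl p))) (Subtype.ext ?_)
    exact (AlgEquiv.restrictNormal_commutes g' L' (x : L')).symm
  -- The discrepancy fixes the residue field of `L'`, so it is realized by some s fixing `L'`.
  -- Replacing g' by g' * s corrects the residual action without changing the restriction to `L'`.
  obtain ⟨s, hs, hsτ⟩ := exists_residueAut_eq L'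
    ((galResidue L g')⁻¹ * residueFrob p (PadicAlgCl p) ^ n) (fun x => by
      rw [RingAut.mul_apply, ← hg'res, ← RingAut.mul_apply, inv_mul_cancel]
      rfl)
  have hw : galResidue L (g' * s) = residueFrob p (PadicAlgCl p) ^ n := by
    rw [map_mul, hsτ, mul_inv_cancel_left]
  refine ⟨⟨g' * s, n, hw.symm⟩, ?_, frobExp_unique _ hw.symm⟩
  have hs1 : AlgEquiv.restrictNormalHom L' s = 1 := by
    ext x
    exact (AlgEquiv.restrictNormal_commutes s L' x).trans (hs x)
  change AlgEquiv.restrictNormalHom L' (g' * s) = g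
  rw [map_mul, hg', hs1, mul_one]

lemma exists_weilToGal_eq [FiniteDimensional ℚ_[p] (MaxUnram p L')] (g : L' ≃ₐ[L] L') :
    ∃ w : weilGroup L, weilToGal L' w = g := by
  obtain ⟨n, hn⟩ := exists_frob_zpow_eq p L' (galUnram L' g)
  obtain ⟨w, hw, -⟩ := exists_weilToGal_eq_and_frobExp_eq L' hn.symm
  exact ⟨w, hw⟩

end Lift

/-! ### Expansions in trace-dual bases. -/

section TraceDual

variable {k F ι : Type*} [Field k] [Field F] [Algebra k F] [FiniteDimensional k F]
  [Algebra.IsSeparable k F] [Fintype ι] [DecidableEq ι]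

/-- The basis dual to `b` with respect to the trace form. -/
def traceDualBasis (b : Module.Basis ι k F) : Module.Basis ι k F :=
  (Algebra.traceForm k F).dualBasis (traceForm_nondegenerate k F) b

lemma sum_trace_smul_traceDualBasis (b : Module.Basis ι k F) (x : F) :
    ∑ i, Algebra.trace k F (x * b i) • traceDualBasis b i = x := by
  conv_rhs => rw [← (traceDualBasis b).sum_repr x]
  refine Finset.sum_congr rfl fun i _ => ?_
  rw [traceDualBasis, LinearMap.BilinForm.dualBasis_repr_apply, Algebra.traceForm_apply]

lemma sum_trace_smul_basis (b : Module.Basis ι k F) (x : F) :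
    ∑ i, Algebra.trace k F (x * traceDualBasis b i) • b i = x := by
  have h : traceDualBasis (traceDualBasis b) = b :=
    LinearMap.BilinForm.dualBasis_dualBasis (traceForm_nondegenerate k F)
      (Algebra.traceForm_isSymm k) b
  conv_rhs => rw [← sum_trace_smul_traceDualBasis (traceDualBasis b) x, h]

end TraceDual

/-! ### The decomposition of E₀ ⊗ K into copies of K. -/

section Idempotents

variable {p : ℕ} [Fact p.Prime] {E : Type*} [Field E] [Algebra ℚ_[p] E]
  [Algebra.IsAlgebraic ℚ_[p] E] {K : Type*} [Field K] [Algebra ℚ_[p] K]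
  (σ₀ : MaxUnram p E →ₐ[ℚ_[p]] K)

/-- The embedding `σ₀ ∘ φ₀⁻ⁿ` of `E₀` in `K`. -/
def frobTwist (n : ℤ) : MaxUnram p E →ₐ[ℚ_[p]] K :=
  σ₀.comp (frob p E ^ (-n) : MaxUnram p E ≃ₐ[ℚ_[p]] MaxUnram p E)

lemma frobTwist_apply (n : ℤ) (l : MaxUnram p E) :
    frobTwist σ₀ n l = σ₀ ((frob p E ^ (-n)) l) := rfl

@[simp]
lemma frobTwist_zero : frobTwist σ₀ 0 = σ₀ := by
  ext l
  simp [frobTwist_apply]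

lemma frobTwist_zpow (m n : ℤ) (l : MaxUnram p E) :
    frobTwist σ₀ n ((frob p E ^ m) l) = frobTwist σ₀ (n - m) l := by
  rw [frobTwist_apply, frobTwist_apply, ← AlgEquiv.mul_apply, ← zpow_add]
  congr 3
  ring

/-- The homomorphism `E₀ ⊗ K → K` induced by the embedding `σ₀ ∘ φ₀⁻ⁿ`. -/
def tensorEval (n : ℤ) : MaxUnram p E ⊗[ℚ_[p]] K →ₐ[ℚ_[p]] K :=
  Algebra.TensorProduct.productMap (frobTwist σ₀ n) (AlgHom.id ℚ_[p] K)

@[simp]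
lemma tensorEval_tmul (n : ℤ) (l : MaxUnram p E) (k : K) :
    tensorEval σ₀ n (l ⊗ₜ k) = frobTwist σ₀ n l * k := by
  simp [tensorEval]

variable [FiniteDimensional ℚ_[p] (MaxUnram p E)]

lemma frobTwist_eq_iff {m n : ℤ} : frobTwist σ₀ m = frobTwist σ₀ n ↔
    (Module.finrank ℚ_[p] (MaxUnram p E) : ℤ) ∣ m - n := by
  rw [← orderOf_frob, orderOf_dvd_iff_zpow_eq_one]
  constructor
  · intro h
    ext l
    apply σ₀.injective
    have := DFunLike.congr_fun h ((frob p E ^ m) l)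
    rw [frobTwist_zpow, frobTwist_zpow, frobTwist_apply, frobTwist_apply] at this
    simpa using this.symm
  · intro h
    ext l
    have := frobTwist_zpow σ₀ (m - n) m l
    rw [h] at this
    simpa using this

lemma tensorEval_eq_of_dvd {m n : ℤ}
    (h : (Module.finrank ℚ_[p] (MaxUnram p E) : ℤ) ∣ m - n) :
    tensorEval σ₀ m = tensorEval σ₀ n := by
  rw [tensorEval, tensorEval, (frobTwist_eq_iff σ₀).2 h]

/-- The idempotent of `E₀ ⊗ K` that cuts out the component of `σ₀ ∘ φ₀⁻ⁿ`. -/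
def componentIdem (n : ℤ) : MaxUnram p E ⊗[ℚ_[p]] K :=
  ∑ i, traceDualBasis (Module.finBasis ℚ_[p] (MaxUnram p E)) i ⊗ₜ
    frobTwist σ₀ n (Module.finBasis ℚ_[p] (MaxUnram p E) i)

/-- Multiplication by l is self-adjoint for the trace form, so its matrices in a basis and in the
dual basis are transposes of each other. This moves l across the tensor sign in Σ bᵢ* ⊗ τ(bᵢ), where
it becomes τ(l) for τ = σ₀ ∘ φ₀⁻ⁿ. -/
lemma mul_componentIdem (n : ℤ) (r : MaxUnram p E ⊗[ℚ_[p]] K) :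
    r * componentIdem σ₀ n = (1 ⊗ₜ tensorEval σ₀ n r) * componentIdem σ₀ n := by
  induction r with
  | zero => simp
  | add x y hx hy => rw [add_mul, hx, hy, map_add, TensorProduct.tmul_add, add_mul]
  | tmul l k =>
    have key : (l ⊗ₜ[ℚ_[p]] (1 : K)) * componentIdem σ₀ n =
        (1 ⊗ₜ frobTwist σ₀ n l) * componentIdem σ₀ n := by
      set b := Module.finBasis ℚ_[p] (MaxUnram p E) with hb
      -- The two expansions `h1` and `h2` have the same coefficients tr(l bⱼ* bᵢ), summed over i in
      -- one and over j in the other.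
      have h1 : ∀ j, l * traceDualBasis b j =
          ∑ i, Algebra.trace ℚ_[p] (MaxUnram p E) (l * traceDualBasis b j * b i) •
            traceDualBasis b i := fun j => (sum_trace_smul_traceDualBasis b _).symm
      have h2 : ∀ i, l * b i =
          ∑ j, Algebra.trace ℚ_[p] (MaxUnram p E) (l * traceDualBasis b j * b i) • b j := by
        intro i
        conv_lhs => rw [← sum_trace_smul_basis b (l * b i)]
        refine Finset.sum_congr rfl fun j _ => ?_
        rw [mul_right_comm]
      simp only [componentIdem, Finset.mul_sum, Algebra.TensorProduct.tmul_mul_tmul, one_mul,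
        ← map_mul, ← hb]
      trans ∑ j, ∑ i, Algebra.trace ℚ_[p] (MaxUnram p E) (l * traceDualBasis b j * b i) •
        (traceDualBasis b i ⊗ₜ[ℚ_[p]] frobTwist σ₀ n (b j))
      · refine Finset.sum_congr rfl fun j _ => ?_
        conv_lhs => rw [h1 j]
        simp only [TensorProduct.sum_tmul, TensorProduct.smul_tmul']
      · rw [Finset.sum_comm]
        refine Finset.sum_congr rfl fun i _ => ?_
        rw [h2 i]
        simp only [map_sum, map_smul, TensorProduct.tmul_sum, TensorProduct.tmul_smul]
    have hl : l ⊗ₜ[ℚ_[p]] k = (1 ⊗ₜ k) * (l ⊗ₜ 1) := by simp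
    rw [hl, mul_assoc, key, ← mul_assoc, ← hl]
    simp [mul_comm]

/-- The powers φ₀⁻ⁿ for 0 ≤ n < f run once through the Galois group, so Σₙ σ₀(φ₀⁻ⁿ x) is the trace
of x. The sum of the idempotents is then Σ tr(bᵢ) bᵢ* ⊗ 1, and Σ tr(bᵢ) bᵢ* is the expansion of 1.
-/
lemma sum_componentIdem :
    ∑ n ∈ Finset.range (Module.finrank ℚ_[p] (MaxUnram p E)), componentIdem σ₀ n = 1 := by
  have htr : ∀ x : MaxUnram p E,
      ∑ n ∈ Finset.range (Module.finrank ℚ_[p] (MaxUnram p E)), frobTwist σ₀ n x =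
        algebraMap ℚ_[p] K (Algebra.trace ℚ_[p] (MaxUnram p E) x) := by
    intro x
    have h1 : algebraMap ℚ_[p] K (Algebra.trace ℚ_[p] (MaxUnram p E) x) =
        σ₀ (algebraMap ℚ_[p] _ (Algebra.trace ℚ_[p] (MaxUnram p E) x)) := (σ₀.commutes _).symm
    rw [h1, trace_eq_sum_automorphisms, map_sum]
    refine Finset.sum_bij (fun n _ => frob p E ^ (-(n : ℤ))) (fun _ _ => Finset.mem_univ _) ?_ ?_
      (fun n _ => rfl)
    · intro m hm n hn h
      rw [zpow_neg, zpow_neg, inv_inj, zpow_natCast, zpow_natCast] at h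
      rw [← orderOf_frob, Finset.mem_range] at hm hn
      exact pow_injOn_Iio_orderOf hm hn h
    · intro g _
      obtain ⟨n, hn⟩ := mem_powers_iff_mem_zpowers.2
        (zpowers_frob p E ▸ Subgroup.mem_top g⁻¹)
      simp only at hn
      refine ⟨n % orderOf (frob p E), ?_, ?_⟩
      · rw [Finset.mem_range, ← orderOf_frob]
        exact Nat.mod_lt _ (orderOf_pos _)
      · rw [zpow_neg, zpow_natCast, pow_mod_orderOf, hn, inv_inv]
  simp only [componentIdem]
  rw [Finset.sum_comm]
  simp only [← TensorProduct.tmul_sum, htr]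
  have h := sum_trace_smul_traceDualBasis (Module.finBasis ℚ_[p] (MaxUnram p E)) 1
  simp only [one_mul] at h
  rw [Algebra.TensorProduct.one_def]
  conv_rhs => rw [← h]
  rw [TensorProduct.sum_tmul]
  refine Finset.sum_congr rfl fun i _ => ?_
  rw [TensorProduct.smul_tmul, Algebra.algebraMap_eq_smul_one]

/-- Some l has different images under the two embeddings. Evaluating (l ⊗ 1) e_n in both ways forces
the value of e_n to vanish. -/
lemma tensorEval_componentIdem_of_not_dvd {m n : ℤ}
    (h : ¬ (Module.finrank ℚ_[p] (MaxUnram p E) : ℤ) ∣ m - n) :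
    tensorEval σ₀ m (componentIdem σ₀ n) = 0 := by
  rw [← frobTwist_eq_iff σ₀, DFunLike.ext_iff, not_forall] at h
  obtain ⟨l, hl⟩ := h
  have := congrArg (tensorEval σ₀ m) (mul_componentIdem σ₀ n (l ⊗ₜ 1))
  rw [map_mul, map_mul] at this
  simp only [tensorEval_tmul, mul_one, map_one, one_mul] at this
  by_contra h0
  exact hl (mul_right_cancel₀ h0 this)

lemma eq_of_mem_range_of_dvd {f m n : ℕ} (hm : m ∈ Finset.range f) (hn : n ∈ Finset.range f)
    (h : (f : ℤ) ∣ (m : ℤ) - n) : m = n := by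
  rw [Finset.mem_range] at hm hn
  exact Nat.ModEq.eq_of_lt_of_lt ((Nat.modEq_iff_dvd.2 h).symm) hm hn

/-- The off-diagonal values vanish, so the diagonal ones are 1 because the idempotents sum to 1. -/
lemma tensorEval_componentIdem {m n : ℕ}
    (hm : m ∈ Finset.range (Module.finrank ℚ_[p] (MaxUnram p E)))
    (hn : n ∈ Finset.range (Module.finrank ℚ_[p] (MaxUnram p E))) :
    tensorEval σ₀ m (componentIdem σ₀ n) = if m = n then 1 else 0 := by
  have hne : ∀ n ∈ Finset.range (Module.finrank ℚ_[p] (MaxUnram p E)), m ≠ n →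
      tensorEval σ₀ m (componentIdem σ₀ n) = 0 := fun n hn h =>
    tensorEval_componentIdem_of_not_dvd σ₀ fun hd => h (eq_of_mem_range_of_dvd hm hn hd)
  split_ifs with h
  · subst h
    have := congrArg (tensorEval σ₀ m) (sum_componentIdem σ₀)
    rwa [map_sum, map_one, Finset.sum_eq_single_of_mem m hm fun n hn h => hne n hn h.symm] at this
  · exact hne n hn h

/-- Together with `eq_zero_of_tensorEval_eq_zero`, this says that the f evaluations identify E₀ ⊗ K
with K^f. -/
lemma exists_tensorEval_eq (c : ℕ → K) : ∃ r : MaxUnram p E ⊗[ℚ_[p]] K,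
    ∀ n ∈ Finset.range (Module.finrank ℚ_[p] (MaxUnram p E)), tensorEval σ₀ n r = c n := by
  refine ⟨∑ n ∈ Finset.range (Module.finrank ℚ_[p] (MaxUnram p E)),
    (1 ⊗ₜ c n) * componentIdem σ₀ n, fun m hm => ?_⟩
  rw [map_sum, Finset.sum_eq_single_of_mem m hm]
  · simp [tensorEval_componentIdem σ₀ hm hm]
  · intro n hn h
    simp [tensorEval_componentIdem σ₀ hm hn, h.symm]

lemma eq_zero_of_tensorEval_eq_zero {r : MaxUnram p E ⊗[ℚ_[p]] K}
    (h : ∀ n ∈ Finset.range (Module.finrank ℚ_[p] (MaxUnram p E)), tensorEval σ₀ n r = 0) :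
    r = 0 := by
  rw [← mul_one r, ← sum_componentIdem σ₀, Finset.mul_sum]
  refine Finset.sum_eq_zero fun n hn => ?_
  rw [mul_componentIdem, h n hn, TensorProduct.tmul_zero, zero_mul]

end Idempotents

namespace PhiNGalMod

variable {p : ℕ} [Fact p.Prime] {L : IntermediateField ℚ_[p] (PadicAlgCl p)}
  {L' : IntermediateField L (PadicAlgCl p)} {K : Type*} [Field K] [Algebra ℚ_[p] K]

/-! ### The components of a module and the projection to that of σ₀. -/

section Components

variable (D : PhiNGalMod.{w} L' K) (σ₀ : MaxUnram p L' →ₐ[ℚ_[p]] K)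

lemma smul_eq_tensorEval_smul {n : ℤ} {d : D.carrier}
    (hd : d ∈ D.component (frobTwist σ₀ n)) (r : MaxUnram p L' ⊗[ℚ_[p]] K) :
    r • d = tensorEval σ₀ n r • d := by
  induction r with
  | zero => simp
  | add x y hx hy => rw [add_smul, hx, hy, map_add, add_smul]
  | tmul l k =>
    have hl : l ⊗ₜ[ℚ_[p]] k = (1 ⊗ₜ k) * (l ⊗ₜ 1) := by simp
    rw [tensorEval_tmul, hl, mul_smul, hd l, ← smul_def, smul_smul, mul_comm]

lemma smul_coe_component (r : MaxUnram p L' ⊗[ℚ_[p]] K) (d : D.component σ₀) :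
    r • (d : D.carrier) = ((tensorEval σ₀ 0 r • d : D.component σ₀) : D.carrier) :=
  smul_eq_tensorEval_smul D σ₀ (by simp) r

/-- Semilinearity of φ precomposes the embedding with φ₀⁻¹. This is why the components are indexed
by σ₀ ∘ φ₀⁻ⁿ: φ raises the index by 1. -/
lemma φK_zpow_mem_component {n : ℤ} {d : D.carrier}
    (hd : d ∈ D.component (frobTwist σ₀ n)) (m : ℤ) :
    (D.φK ^ m) d ∈ D.component (frobTwist σ₀ (n + m)) := by
  intro l
  obtain ⟨l, rfl⟩ := (frob p L' ^ m).surjective l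
  rw [← φK_zpow_smul, hd l, map_smul, frobTwist_zpow, add_sub_cancel_right]

lemma smul_tensor_comm (k : K) (r : MaxUnram p L' ⊗[ℚ_[p]] K) (d : D.carrier) :
    r • k • d = k • r • d := by
  rw [smul_def, smul_def, smul_smul, smul_smul, mul_comm]

variable [FiniteDimensional ℚ_[p] (MaxUnram p L')]

lemma componentIdem_smul_mem (n : ℤ) (d : D.carrier) :
    componentIdem σ₀ n • d ∈ D.component (frobTwist σ₀ n) := by
  intro l
  rw [smul_smul, mul_componentIdem, tensorEval_tmul, mul_one, mul_smul, ← smul_def]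

lemma sum_componentIdem_smul (d : D.carrier) :
    ∑ n ∈ Finset.range (Module.finrank ℚ_[p] (MaxUnram p L')), componentIdem σ₀ n • d = d := by
  rw [← Finset.sum_smul, sum_componentIdem, one_smul]

/-- The projection of `D` to the component of `σ₀`. -/
def componentProj : D.carrier →ₗ[K] D.component σ₀ where
  toFun d := ⟨componentIdem σ₀ 0 • d, by
    simpa using D.componentIdem_smul_mem σ₀ 0 d⟩
  map_add' x y := Subtype.ext (smul_add _ _ _)
  map_smul' k d := Subtype.ext (D.smul_tensor_comm _ _ _)

lemma coe_componentProj (d : D.carrier) :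
    (D.componentProj σ₀ d : D.carrier) = componentIdem σ₀ 0 • d := rfl

lemma componentProj_of_mem (d : D.component σ₀) : D.componentProj σ₀ d = d := by
  apply Subtype.ext
  have h0 : (0 : ℕ) ∈ Finset.range (Module.finrank ℚ_[p] (MaxUnram p L')) :=
    Finset.mem_range.2 Module.finrank_pos
  have hd : (d : D.carrier) ∈ D.component (frobTwist σ₀ ((0 : ℕ) : ℤ)) := by simp
  rw [coe_componentProj, ← Nat.cast_zero, smul_eq_tensorEval_smul D σ₀ hd,
    tensorEval_componentIdem σ₀ h0 h0, if_pos rfl, one_smul]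

lemma componentProj_of_not_dvd {n : ℤ} {d : D.carrier}
    (hd : d ∈ D.component (frobTwist σ₀ n))
    (hn : ¬ (Module.finrank ℚ_[p] (MaxUnram p L') : ℤ) ∣ n) : D.componentProj σ₀ d = 0 := by
  apply Subtype.ext
  rw [coe_componentProj, smul_eq_tensorEval_smul D σ₀ hd,
    tensorEval_componentIdem_of_not_dvd σ₀ (by rwa [sub_zero]), zero_smul]
  rfl

lemma componentProj_smul (r : MaxUnram p L' ⊗[ℚ_[p]] K) (d : D.carrier) :
    D.componentProj σ₀ (r • d) = tensorEval σ₀ 0 r • D.componentProj σ₀ d := by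
  apply Subtype.ext
  have h := D.componentIdem_smul_mem σ₀ 0 d
  rw [Submodule.coe_smul, coe_componentProj, coe_componentProj,
    ← smul_eq_tensorEval_smul D σ₀ h, smul_smul, smul_smul, mul_comm]

lemma componentProj_N (d : D.carrier) :
    (D.componentProj σ₀ (D.NK d) : D.carrier) = D.NK (D.componentProj σ₀ d) :=
  (D.N.map_smul _ _).symm

variable {D} in
/-- A morphism is determined by its effect on the component of `σ₀`. -/
lemma hom_ext_of_component {D' : PhiNGalMod.{w} L' K} {f g : Hom D D'}
    (h : Hom.component σ₀ f = Hom.component σ₀ g) : f = g := by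
  ext d
  rw [← D.sum_componentIdem_smul σ₀ d, map_sum, map_sum]
  refine Finset.sum_congr rfl fun n _ => ?_
  -- Applying φ⁻ⁿ carries the n-th component to that of σ₀, where the two morphisms agree by
  -- hypothesis.
  have hmem := D.φK_zpow_mem_component σ₀ (D.componentIdem_smul_mem σ₀ n d) (-n)
  rw [add_neg_cancel, frobTwist_zero] at hmem
  have key := congrArg Subtype.val (DFunLike.congr_fun h ⟨_, hmem⟩)
  change f.toLinearMap ((D.φK ^ (-(n : ℤ))) (componentIdem σ₀ n • d)) =
    g.toLinearMap ((D.φK ^ (-(n : ℤ))) (componentIdem σ₀ n • d)) at key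
  rw [hom_φK_zpow, hom_φK_zpow] at key
  exact (D'.φK ^ (-(n : ℤ))).injective key

end Components

/-! ### Fullness: extending an equivariant map from the component of σ₀. -/

section Extension

variable [Normal L L'] (D : PhiNGalMod.{w} L' K) {σ₀ : MaxUnram p L' →ₐ[ℚ_[p]] K}

lemma weilEnd_φK_zpow (w : weilGroup L) (n : ℤ) (d : D.carrier) :
    D.weilEnd w ((D.φK ^ n) d) = (D.φK ^ n) (D.weilEnd w d) := by
  rw [weilEnd_apply, weilEnd_apply, ← LinearEquiv.mul_apply, ← zpow_add, add_comm, zpow_add,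
    LinearEquiv.mul_apply, φK_zpow_gal]

lemma weilEnd_smul_tensor (w : weilGroup L) (r : MaxUnram p L' ⊗[ℚ_[p]] K) (d : D.carrier) :
    D.weilEnd w (r • d) = r • D.weilEnd w d := by
  induction r with
  | zero => simp
  | add x y hx hy => rw [add_smul, map_add, hx, hy, add_smul]
  | tmul l k => exact D.weilEnd_smul w l k d

/-- Solves r(w) = w̄ φ^{-α(w)} for w̄, so that the Galois action is recovered from r and φ. -/
lemma gal_weilToGal (w : weilGroup L) (d : D.carrier) :
    D.gal (weilToGal L' w) d = D.weilEnd w ((D.φK ^ frobExp w) d) := by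
  rw [weilEnd_apply, ← LinearEquiv.mul_apply, ← zpow_add]
  simp [galK_apply]

/-- There is an element of the Weil group that acts as `φ ^ f`, where `f = [L'₀ : ℚ_p]`. -/
lemma exists_weilEnd_eq_φK_zpow [FiniteDimensional ℚ_[p] (MaxUnram p L')] :
    ∃ w : weilGroup L, ∀ (D : PhiNGalMod.{w} L' K) (d : D.carrier),
      D.weilEnd w d = (D.φK ^ (Module.finrank ℚ_[p] (MaxUnram p L') : ℤ)) d := by
  -- The exponent is -f since r(w) involves φ^{-α(w)}. The pair (1, -f) is in the image of the Weil
  -- group because φ₀ has order f.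
  obtain ⟨w, hw, hw'⟩ := exists_weilToGal_eq_and_frobExp_eq L' (g := 1)
    (n := -(Module.finrank ℚ_[p] (MaxUnram p L') : ℤ)) (by
      rw [map_one, zpow_neg, zpow_natCast, ← orderOf_frob, pow_orderOf_eq_one, inv_one])
  refine ⟨w, fun D d => ?_⟩
  rw [weilEnd_apply, hw, hw', neg_neg, map_one]
  rfl

variable {D} {D' : PhiNGalMod.{w} L' K} [FiniteDimensional ℚ_[p] (MaxUnram p L')]
  (h : D.component σ₀ →ₗ[K] D'.component σ₀)

/-- The conjugate by `φⁿ` of a map between the components of `σ₀`, extended by zero to the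
other components. -/
def twistedExtension (n : ℤ) : D.carrier →ₗ[K] D'.carrier :=
  (D'.φK ^ n).toLinearMap ∘ₗ (D'.component σ₀).subtype ∘ₗ h ∘ₗ D.componentProj σ₀ ∘ₗ
    (D.φK ^ (-n)).toLinearMap

omit [Normal L L'] in
lemma twistedExtension_apply (n : ℤ) (d : D.carrier) :
    twistedExtension h n d =
      (D'.φK ^ n) (h (D.componentProj σ₀ ((D.φK ^ (-n)) d)) : D'.carrier) := rfl

omit [Normal L L'] in
lemma twistedExtension_φK_zpow (m n : ℤ) (d : D.carrier) :
    twistedExtension h (n + m) ((D.φK ^ m) d) = (D'.φK ^ m) (twistedExtension h n d) := by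
  rw [twistedExtension_apply, twistedExtension_apply, ← LinearEquiv.mul_apply, ← zpow_add,
    ← LinearEquiv.mul_apply, ← zpow_add, neg_add, neg_add_cancel_right, add_comm]

omit [Normal L L'] in
lemma twistedExtension_smul (n : ℤ) (r : MaxUnram p L' ⊗[ℚ_[p]] K) (d : D.carrier) :
    twistedExtension h n (r • d) = r • twistedExtension h n d := by
  induction r with
  | zero => simp
  | add x y hx hy => rw [add_smul, map_add, hx, hy, add_smul]
  | tmul l k =>
    -- With the scalar written as φ₀ⁿ(l), the twists by φ⁻ⁿ and by φⁿ cancel.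
    obtain ⟨l, rfl⟩ := (frob p L' ^ n).surjective l
    rw [twistedExtension_apply, twistedExtension_apply, ← φK_zpow_smul, D.φK_zpow_smul (-n),
      componentProj_smul, map_smul, ← AlgEquiv.mul_apply, ← zpow_add, neg_add_cancel, zpow_zero,
      AlgEquiv.one_apply]
    congr 1
    exact (D'.smul_coe_component σ₀ _ _).symm

omit [Normal L L'] in
-- Moving N past φ⁻ⁿ gives the factor pⁿ, and moving it past φⁿ gives p⁻ⁿ.
lemma twistedExtension_N (hN : ∀ d : D.component σ₀, (h ⟨D.NK d, N_mem σ₀ d.2⟩ : D'.carrier) = D'.NK (h d))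
    (n : ℤ) (d : D.carrier) :
    twistedExtension h n (D.N d) = D'.N (twistedExtension h n d) := by
  have h1 : D.componentProj σ₀ (D.NK ((D.φK ^ (-n)) d)) =
      ⟨D.NK (D.componentProj σ₀ ((D.φK ^ (-n)) d)), N_mem σ₀ (Subtype.property _)⟩ :=
    Subtype.ext (D.componentProj_N σ₀ _)
  have hp : (p : K) ^ n ≠ 0 := zpow_ne_zero _ natCast_ne_zero_of_algebra
  have h2 := D'.φK_zpow_N (-n) (h (D.componentProj σ₀ ((D.φK ^ (-n)) d)) : D'.carrier)
  rw [neg_neg] at h2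
  rw [← NK_apply, ← NK_apply, twistedExtension_apply, twistedExtension_apply, φK_zpow_N, map_smul,
    map_smul, h1, Submodule.coe_smul, hN, map_smul, h2, smul_smul, zpow_neg, mul_inv_cancel₀ hp,
    one_smul]

section Weil

variable (hr : ∀ (w : weilGroup L) (d : D.component σ₀),
  (h ⟨D.weilEnd w d, weilEnd_mem σ₀ w d.2⟩ : D'.carrier) = D'.weilEnd w (h d))
include hr

/-- The operators r(w) commute with φ, and with the idempotents because they are L'₀ ⊗ K-linear. -/
lemma twistedExtension_weilEnd (n : ℤ) (w : weilGroup L) (d : D.carrier) :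
    twistedExtension h n (D.weilEnd w d) = D'.weilEnd w (twistedExtension h n d) := by
  have h1 : D.componentProj σ₀ (D.weilEnd w ((D.φK ^ (-n)) d)) =
      ⟨D.weilEnd w (D.componentProj σ₀ ((D.φK ^ (-n)) d)),
        weilEnd_mem σ₀ w (Subtype.property _)⟩ :=
    Subtype.ext (D.weilEnd_smul_tensor w _ _).symm
  rw [twistedExtension_apply, twistedExtension_apply, ← weilEnd_φK_zpow, h1, hr, weilEnd_φK_zpow]

/-- Conjugation by φ^f changes nothing: on both modules φ^f is r(w) for one and the same w, and the
twisted extension commutes with r(w). -/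
lemma twistedExtension_add_finrank (n : ℤ) :
    twistedExtension h (n + Module.finrank ℚ_[p] (MaxUnram p L')) = twistedExtension h n := by
  obtain ⟨w, hw⟩ := exists_weilEnd_eq_φK_zpow (L' := L') (K := K)
  ext d
  obtain ⟨d, rfl⟩ := (D.φK ^ (Module.finrank ℚ_[p] (MaxUnram p L') : ℤ)).surjective d
  rw [twistedExtension_φK_zpow, ← hw D, ← hw D', twistedExtension_weilEnd h hr]

variable (hN : ∀ d : D.component σ₀, (h ⟨D.NK d, N_mem σ₀ d.2⟩ : D'.carrier) = D'.NK (h d))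

omit hr in
/-- The linear map that extends a map between the components of `σ₀` equivariantly for `φ`. -/
def extendComponent : D.carrier →ₗ[MaxUnram p L' ⊗[ℚ_[p]] K] D'.carrier where
  toFun d := ∑ n ∈ Finset.range (Module.finrank ℚ_[p] (MaxUnram p L')), twistedExtension h n d
  map_add' x y := by simp only [map_add, Finset.sum_add_distrib]
  map_smul' r d := by simp only [twistedExtension_smul, Finset.smul_sum, RingHom.id_apply]

omit [Normal L L'] hr in
lemma extendComponent_apply (d : D.carrier) : extendComponent h d =
    ∑ n ∈ Finset.range (Module.finrank ℚ_[p] (MaxUnram p L')), twistedExtension h n d := rfl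

omit [Normal L L'] hr in
-- For 0 < n < f, φ⁻ⁿ moves d to a component other than that of σ₀, which the projection kills. Only
-- the term n = 0 survives.
lemma extendComponent_of_mem (d : D.component σ₀) : extendComponent h d = h d := by
  rw [extendComponent_apply, Finset.sum_eq_single_of_mem 0 (Finset.mem_range.2 Module.finrank_pos)]
  · rw [twistedExtension_apply, Nat.cast_zero, neg_zero, zpow_zero, zpow_zero,
      LinearEquiv.coe_one, LinearEquiv.coe_one, id_eq, id_eq, componentProj_of_mem]
  · intro n hn hn0
    have hd : (d : D.carrier) ∈ D.component (frobTwist σ₀ 0) := by simp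
    have hmem := D.φK_zpow_mem_component σ₀ hd (-n)
    rw [twistedExtension_apply, componentProj_of_not_dvd D σ₀ hmem, map_zero]
    · exact map_zero _
    · rw [zero_add, dvd_neg, Int.natCast_dvd_natCast]
      exact fun hdvd => (Nat.le_of_dvd (Nat.pos_of_ne_zero hn0) hdvd).not_gt
        (Finset.mem_range.1 hn)

/-- Passing φ through the sum shifts the range {0, …, f - 1} to {1, …, f}. By periodicity the terms
at 0 and f are equal, so the sum is unchanged. -/
lemma extendComponent_φ (d : D.carrier) :
    extendComponent h (D.φ d) = D'.φ (extendComponent h d) := by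
  have hstep : ∀ n : ℤ, twistedExtension h (n + 1) (D.φ d) = D'.φ (twistedExtension h n d) :=
    fun n => by simpa [φK_apply] using twistedExtension_φK_zpow h 1 n d
  rw [extendComponent_apply, extendComponent_apply, map_sum]
  simp only [← hstep]
  have hper := twistedExtension_add_finrank h hr 0
  rw [zero_add] at hper
  have := (Finset.sum_range_succ (fun n : ℕ => twistedExtension h n (D.φ d))
    (Module.finrank ℚ_[p] (MaxUnram p L'))).symm.trans (Finset.sum_range_succ' _ _)
  rw [hper, Nat.cast_zero] at this
  simpa using this

variable (hN : ∀ d : D.component σ₀, (h ⟨D.NK d, N_mem σ₀ d.2⟩ : D'.carrier) = D'.NK (h d))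

/-- The morphism that extends a map between the components of `σ₀`. -/
def homOfComponent : Hom D D' where
  toLinearMap := extendComponent h
  φ_comm := extendComponent_φ h hr
  N_comm d := by
    rw [extendComponent_apply, extendComponent_apply, map_sum]
    exact Finset.sum_congr rfl fun n _ => twistedExtension_N h hN n d
  gal_comm g d := by
    -- Since w̄ = r(w) φ^{α(w)}, commuting with φ and with r is enough.
    obtain ⟨w, rfl⟩ := exists_weilToGal_eq L' g
    have hφ : ∀ (n : ℤ) (d : D.carrier),
        extendComponent h ((D.φK ^ n) d) = (D'.φK ^ n) (extendComponent h d) := by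
      intro n
      induction n with
      | zero => simp
      | succ n ih =>
        intro d
        rw [zpow_add_one, zpow_add_one, LinearEquiv.mul_apply, LinearEquiv.mul_apply, ih,
          φK_apply, extendComponent_φ h hr]
        rfl
      | pred n ih =>
        intro d
        obtain ⟨d, rfl⟩ := D.φK.surjective d
        have h1 : extendComponent h (D.φK d) = D'.φK (extendComponent h d) :=
          extendComponent_φ h hr d
        rw [h1, ← LinearEquiv.mul_apply, ← LinearEquiv.mul_apply, ← zpow_add_one,
          ← zpow_add_one]
        simpa using ih d
    rw [gal_weilToGal, gal_weilToGal, ← hφ, extendComponent_apply, extendComponent_apply, map_sum]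
    exact Finset.sum_congr rfl fun n _ => twistedExtension_weilEnd h hr n w _

lemma component_homOfComponent : Hom.component σ₀ (homOfComponent h hr hN) = h :=
  LinearMap.ext fun d => Subtype.ext (extendComponent_of_mem h d)

end Weil

end Extension

end PhiNGalMod

open CategoryTheory

/-! ### The kernel of the map from the Weil group to Gal(L'/L). -/

section WeilKernel

variable {p : ℕ} [Fact p.Prime] {L : IntermediateField ℚ_[p] (PadicAlgCl p)}
  (L' : IntermediateField L (PadicAlgCl p))

lemma frobExp_inv (w : weilGroup L) : frobExp w⁻¹ = -frobExp w := by
  have h := frobExp_mul w w⁻¹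
  rw [mul_inv_cancel, frobExp_one] at h
  linarith

lemma frobExp_zpow (w : weilGroup L) (n : ℤ) : frobExp (w ^ n) = n * frobExp w := by
  induction n with
  | zero => simp [frobExp_one]
  | succ n ih => rw [zpow_add_one, frobExp_mul, ih]; ring
  | pred n ih => rw [zpow_sub_one, frobExp_mul, frobExp_inv, ih]; ring

variable [Normal L L'] [FiniteDimensional ℚ_[p] (MaxUnram p L')]

/-- Such an s acts trivially on L'₀, but also as φ₀^{α(s)}, and φ₀ has order f. -/
lemma finrank_dvd_frobExp {s : weilGroup L} (hs : weilToGal L' s = 1) :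
    (Module.finrank ℚ_[p] (MaxUnram p L') : ℤ) ∣ frobExp s := by
  rw [← orderOf_frob, orderOf_dvd_iff_zpow_eq_one, ← galUnram_weilToGal, hs, map_one]

lemma exists_frobExp_eq_finrank : ∃ s : weilGroup L, weilToGal L' s = 1 ∧
    frobExp s = Module.finrank ℚ_[p] (MaxUnram p L') := by
  apply exists_weilToGal_eq_and_frobExp_eq
  rw [map_one, zpow_natCast, ← orderOf_frob, pow_orderOf_eq_one]

/-- An element of the Weil group of `L'` that acts on the residue field of `ℚ̄_p` as the
Frobenius of `L'`. -/
def frobLift : weilGroup L := (exists_frobExp_eq_finrank L').choose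

lemma weilToGal_frobLift_zpow (n : ℤ) : weilToGal L' (frobLift L' ^ n) = 1 := by
  have h : weilToGal L' (frobLift L') = 1 := (exists_frobExp_eq_finrank L').choose_spec.1
  rw [map_zpow, h, one_zpow]

lemma frobExp_frobLift_zpow (n : ℤ) :
    frobExp (frobLift L' ^ n) = Module.finrank ℚ_[p] (MaxUnram p L') * n := by
  rw [frobExp_zpow, mul_comm]
  congr 1
  exact (exists_frobExp_eq_finrank L').choose_spec.2

end WeilKernel

/-! ### Essential surjectivity: the module induced by a representation. -/

namespace WeilDeligneRep

variable {p : ℕ} [Fact p.Prime] {L : IntermediateField ℚ_[p] (PadicAlgCl p)}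
  (L' : IntermediateField L (PadicAlgCl p)) {K : Type*} [Field K] [Algebra ℚ_[p] K]
  (V : WeilDeligneRep.{w} L K) [Normal L L']

variable {V L'} in
omit [Algebra ℚ_[p] K] in
-- An element with trivial image in Gal(L'/L) and α = 0 lies in the inertia group of L', where r is
-- trivial. Hence r(w) depends only on the pair (w̄, α(w)).
lemma IsUnramifiedOver.r_eq (hV : IsUnramifiedOver L' V) {v w : weilGroup L}
    (h : weilToGal L' v = weilToGal L' w) (h' : frobExp v = frobExp w) : V.r v = V.r w := by
  have h1 : weilToGal L' (v⁻¹ * w) = 1 := by rw [map_mul, map_inv, h, inv_mul_cancel]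
  have h2 : frobExp (v⁻¹ * w) = 0 := by rw [frobExp_mul, frobExp_inv, h', neg_add_cancel]
  have h3 : V.r (v⁻¹ * w) = 1 := by
    refine hV _ (fun x => ?_) ?_
    · have := AlgEquiv.restrictNormal_commutes 
        ((v⁻¹ * w : weilGroup L) : PadicAlgCl p ≃ₐ[L] PadicAlgCl p) L' x
      exact this.symm.trans (congrArg (algebraMap L' (PadicAlgCl p)) (DFunLike.congr_fun h1 x))
    · have := frobExp_spec (v⁻¹ * w)
      rw [h2, zpow_zero] at this
      exact this.symm
  rw [← mul_inv_cancel_left v w, map_mul V.r v, h3, mul_one]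

/-- The functions `ℤ → V` that are equivariant under the Weil group of `L'`, which acts on `ℤ`
by translation through `α`. -/
def equivariantFun : AddSubgroup (ℤ → V.carrier) where
  carrier := {F | ∀ s : weilGroup L, weilToGal L' s = 1 →
    ∀ n, V.r s (F n) = F (n + frobExp s)}
  add_mem' hF hG s hs n := by simp [hF s hs n, hG s hs n]
  zero_mem' s _ n := by simp
  neg_mem' hF s hs n := by simp [hF s hs n]

/-- The `L'₀ ⊗ K`-module induced by `V`, with `L'₀` acting on the values at `n` through
`σ₀ ∘ φ₀⁻ⁿ`. -/
def Induced (_ : MaxUnram p L' →ₐ[ℚ_[p]] K) : Type w := equivariantFun L' V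

namespace Induced

variable {L' V} {σ₀ : MaxUnram p L' →ₐ[ℚ_[p]] K}

instance : AddCommGroup (V.Induced L' σ₀) :=
  inferInstanceAs (AddCommGroup (equivariantFun L' V))

/-- An element of the induced module as a function. -/
def eval (F : V.Induced L' σ₀) : ℤ → V.carrier := Subtype.val (show equivariantFun L' V from F)

variable (σ₀) in
/-- An equivariant function as an element of the induced module. -/
def mk (F : ℤ → V.carrier) (hF : ∀ s : weilGroup L, weilToGal L' s = 1 →
    ∀ n, V.r s (F n) = F (n + frobExp s)) : V.Induced L' σ₀ :=
  show equivariantFun L' V from ⟨F, hF⟩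

instance : CoeFun (V.Induced L' σ₀) (fun _ => ℤ → V.carrier) := ⟨eval⟩

@[ext]
lemma ext {F G : V.Induced L' σ₀} (h : ∀ n, F n = G n) : F = G :=
  Subtype.ext (p := (· ∈ equivariantFun L' V)) (funext h)

lemma equivariant (F : V.Induced L' σ₀) {s : weilGroup L} (hs : weilToGal L' s = 1) (n : ℤ) :
    V.r s (F n) = F (n + frobExp s) := F.2 s hs n

@[simp] lemma zero_apply (n : ℤ) : (0 : V.Induced L' σ₀) n = 0 := rfl

@[simp] lemma nsmul_apply (m : ℕ) (F : V.Induced L' σ₀) (n : ℤ) : (m • F) n = m • F n := rfl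

@[simp] lemma sum_apply {ι : Type*} (s : Finset ι) (F : ι → V.Induced L' σ₀) (n : ℤ) :
    (∑ i ∈ s, F i) n = ∑ i ∈ s, F i n := by
  let e : V.Induced L' σ₀ →+ V.carrier := ⟨⟨fun F => F n, rfl⟩, fun _ _ => rfl⟩
  exact map_sum e F s

variable [FiniteDimensional ℚ_[p] (MaxUnram p L')]

/-- Equivariance is preserved because α(s) is a multiple of f, so the embeddings at n and at n +
α(s) coincide. -/
instance : Module (MaxUnram p L' ⊗[ℚ_[p]] K) (V.Induced L' σ₀) where
  smul r F := mk σ₀ (fun n => tensorEval σ₀ n r • F n) fun s hs n => by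
    rw [map_smul, F.equivariant hs, tensorEval_eq_of_dvd σ₀ (m := n + frobExp s) (n := n)]
    simpa using finrank_dvd_frobExp L' hs
  one_smul F := by ext n; exact (congrArg (· • F n) (map_one _)).trans (one_smul _ _)
  mul_smul r s F := by ext n; exact (congrArg (· • F n) (map_mul _ r s)).trans (mul_smul _ _ _)
  smul_zero r := by ext n; exact smul_zero _
  smul_add r F G := by ext n; exact smul_add _ _ _
  add_smul r s F := by ext n; exact (congrArg (· • F n) (map_add _ r s)).trans (add_smul _ _ _)
  zero_smul F := by ext n; exact (congrArg (· • F n) (map_zero _)).trans (zero_smul _ _)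

@[simp]
lemma smul_apply (r : MaxUnram p L' ⊗[ℚ_[p]] K) (F : V.Induced L' σ₀) (n : ℤ) :
    (r • F) n = tensorEval σ₀ n r • F n := rfl

/-- A power of `frobLift` carries the value at n mod f to the value at n, so the values on {0, …, f
- 1} determine the function. -/
lemma apply_eq (F : V.Induced L' σ₀) (n : ℤ) :
    F n = V.r (frobLift L' ^ (n / Module.finrank ℚ_[p] (MaxUnram p L')))
      (F (n % Module.finrank ℚ_[p] (MaxUnram p L'))) := by
  rw [F.equivariant (weilToGal_frobLift_zpow L' _), frobExp_frobLift_zpow,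
    Int.emod_add_mul_ediv]

lemma ext_range {F G : V.Induced L' σ₀}
    (h : ∀ n ∈ Finset.range (Module.finrank ℚ_[p] (MaxUnram p L')), F n = G n) : F = G := by
  ext n
  have hf : (0 : ℤ) < Module.finrank ℚ_[p] (MaxUnram p L') := by
    exact_mod_cast Module.finrank_pos
  obtain ⟨m, hm⟩ := Int.eq_ofNat_of_zero_le (Int.emod_nonneg n hf.ne')
  rw [F.apply_eq, G.apply_eq, hm, h m]
  have := Int.emod_lt_of_pos n hf
  rw [Finset.mem_range]
  omega

variable (σ₀) in
/-- The equivariant function with prescribed values on `{0, …, f - 1}`, where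
`f = [L'₀ : ℚ_p]`. -/
def periodize (hV : IsUnramifiedOver L' V) (v : ℤ → V.carrier) : V.Induced L' σ₀ :=
  mk σ₀ (fun n => V.r (frobLift L' ^ (n / Module.finrank ℚ_[p] (MaxUnram p L')))
      (v (n % Module.finrank ℚ_[p] (MaxUnram p L')))) fun s hs n => by
    obtain ⟨j, hj⟩ := finrank_dvd_frobExp L' hs
    have hf : (Module.finrank ℚ_[p] (MaxUnram p L') : ℤ) ≠ 0 := by
      exact_mod_cast Module.finrank_pos.ne'
    -- This is where unramifiedness enters: s and this power of the Frobenius lift have the same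
    -- image in Gal(L'/L) and the same α.
    have hr : V.r s = V.r (frobLift L' ^ j) := hV.r_eq
      (by rw [hs, weilToGal_frobLift_zpow]) (by rw [frobExp_frobLift_zpow, hj])
    rw [hr, hj, Int.add_mul_ediv_left _ _ hf, Int.add_mul_emod_self_left, add_comm, zpow_add,
      map_mul]
    rfl

lemma periodize_apply (hV : IsUnramifiedOver L' V) (v : ℤ → V.carrier) (n : ℤ) :
    periodize σ₀ hV v n = V.r (frobLift L' ^ (n / Module.finrank ℚ_[p] (MaxUnram p L')))
      (v (n % Module.finrank ℚ_[p] (MaxUnram p L'))) := rfl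

lemma periodize_apply_of_mem (hV : IsUnramifiedOver L' V) (v : ℤ → V.carrier) {n : ℕ}
    (hn : n ∈ Finset.range (Module.finrank ℚ_[p] (MaxUnram p L'))) :
    periodize σ₀ hV v n = v n := by
  rw [Finset.mem_range] at hn
  rw [periodize_apply, Int.ediv_eq_zero_of_lt (by positivity) (by exact_mod_cast hn),
    Int.emod_eq_of_lt (by positivity) (by exact_mod_cast hn), zpow_zero, map_one]
  rfl

variable (σ₀) in
/-- A basis of `V` over `K` gives a basis of the induced module over `L'₀ ⊗ K`. -/
def piEquiv (hV : IsUnramifiedOver L' V) {ι : Type*} [Fintype ι]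
    (b : Module.Basis ι K V.carrier) :
    (ι → MaxUnram p L' ⊗[ℚ_[p]] K) ≃ₗ[MaxUnram p L' ⊗[ℚ_[p]] K] V.Induced L' σ₀ := by
  have hmap : ∀ (r : ι → MaxUnram p L' ⊗[ℚ_[p]] K),
      ∀ n ∈ Finset.range (Module.finrank ℚ_[p] (MaxUnram p L')),
      (Fintype.linearCombination (MaxUnram p L' ⊗[ℚ_[p]] K)
        (fun i => periodize σ₀ hV fun _ => b i) r : V.Induced L' σ₀) n =
        ∑ i, tensorEval σ₀ n (r i) • b i := by
    intro r n hn
    simp only [Fintype.linearCombination_apply, sum_apply, smul_apply,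
      periodize_apply_of_mem hV _ hn]
  -- The basis vectors are the functions with constant value b i on {0, …, f - 1}. Both injectivity
  -- and surjectivity are checked at each such n, using L'₀ ⊗ K = K^f for the coefficients.
  refine LinearEquiv.ofBijective
    (Fintype.linearCombination (MaxUnram p L' ⊗[ℚ_[p]] K)
      fun i => periodize σ₀ hV fun _ => b i) ⟨?_, ?_⟩
  · rw [injective_iff_map_eq_zero]
    intro r hr
    ext i
    refine eq_zero_of_tensorEval_eq_zero σ₀ fun n hn => ?_
    have h := hmap r n hn
    rw [hr, zero_apply] at h
    exact Fintype.linearIndependent_iff.1 b.linearIndependent _ h.symm i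
  · intro F
    choose r hr using fun i => exists_tensorEval_eq σ₀ fun n => b.repr (F n) i
    refine ⟨r, ext_range fun n hn => ?_⟩
    rw [hmap r n hn]
    simp only [hr _ n hn]
    exact b.sum_repr _

/-- The operator of an element `w` of the Weil group: `F ↦ (n ↦ r(w) F(n - α(w)))`. -/
def weilAct (w : weilGroup L) : AddMonoid.End (V.Induced L' σ₀) where
  -- Conjugating s by w stays in the kernel, which is normal, and does not change α, whose target is
  -- commutative.
  toFun F := mk σ₀ (fun n => V.r w (F (n - frobExp w))) fun s hs n => by
    have hs' : weilToGal L' (w⁻¹ * s * w) = 1 := by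
      rw [map_mul, map_mul, hs, map_inv, mul_one, inv_mul_cancel]
    have hexp : frobExp (w⁻¹ * s * w) = frobExp s := by
      rw [frobExp_mul, frobExp_mul, frobExp_inv]; ring
    have h := F.equivariant hs' (n - frobExp w)
    rw [hexp] at h
    rw [add_sub_right_comm, ← h, ← Module.End.mul_apply, ← Module.End.mul_apply, ← map_mul,
      ← map_mul, mul_assoc, mul_inv_cancel_left]
  map_zero' := by ext n; exact map_zero _
  map_add' F G := by ext n; exact map_add _ _ _

omit [FiniteDimensional ℚ_[p] (MaxUnram p L')] in
lemma weilAct_apply (w : weilGroup L) (F : V.Induced L' σ₀) (n : ℤ) :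
    weilAct w F n = V.r w (F (n - frobExp w)) := rfl

omit [FiniteDimensional ℚ_[p] (MaxUnram p L')] in
-- Write v = w (w⁻¹ v). The equivariance of F under w⁻¹ v turns its action into a translation, which
-- absorbs the difference between α(v) and α(w). The action therefore descends to Gal(L'/L),
-- although r need not.
lemma weilAct_eq {v w : weilGroup L} (h : weilToGal L' v = weilToGal L' w) :
    (weilAct v : AddMonoid.End (V.Induced L' σ₀)) = weilAct w := by
  ext F n
  have hs : weilToGal L' (w⁻¹ * v) = 1 := by rw [map_mul, map_inv, h, inv_mul_cancel]
  have hF := F.equivariant hs (n - frobExp v)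
  rw [weilAct_apply, weilAct_apply, ← mul_inv_cancel_left w v, map_mul V.r w, mul_inv_cancel_left,
    Module.End.mul_apply, hF, frobExp_mul, frobExp_inv]
  congr 2
  ring

/-- The action of `Gal(L'/L)` on the induced module. -/
def gal : (L' ≃ₐ[L] L') →* AddMonoid.End (V.Induced L' σ₀) where
  toFun g := weilAct (exists_weilToGal_eq L' g).choose
  map_one' := by
    rw [weilAct_eq (w := 1) ((exists_weilToGal_eq L' 1).choose_spec.trans (map_one _).symm)]
    ext F n
    rw [weilAct_apply, frobExp_one, sub_zero, map_one]
    rfl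
  map_mul' g h := by
    rw [weilAct_eq (w := (exists_weilToGal_eq L' g).choose * (exists_weilToGal_eq L' h).choose)
      (by rw [map_mul, (exists_weilToGal_eq L' g).choose_spec,
        (exists_weilToGal_eq L' h).choose_spec, (exists_weilToGal_eq L' (g * h)).choose_spec])]
    ext F n
    rw [weilAct_apply, frobExp_mul, map_mul, ← sub_sub]
    rfl

lemma gal_weilToGal (w : weilGroup L) :
    (gal (weilToGal L' w) : AddMonoid.End (V.Induced L' σ₀)) = weilAct w :=
  weilAct_eq (exists_weilToGal_eq L' (weilToGal L' w)).choose_spec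

/-- The Frobenius of the induced module. -/
def shift : V.Induced L' σ₀ ≃+ V.Induced L' σ₀ where
  toFun F := mk σ₀ (fun n => F (n - 1)) fun s hs n => by
    rw [F.equivariant hs, sub_add_eq_add_sub]
  invFun F := mk σ₀ (fun n => F (n + 1)) fun s hs n => by
    rw [F.equivariant hs, add_right_comm]
  left_inv F := by ext n; exact congrArg F (add_sub_cancel_right n 1)
  right_inv F := by ext n; exact congrArg F (sub_add_cancel n 1)
  map_add' _ _ := rfl

omit [FiniteDimensional ℚ_[p] (MaxUnram p L')] in
lemma shift_apply (F : V.Induced L' σ₀) (n : ℤ) : shift F n = F (n - 1) := rfl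

/-- The monodromy operator of the induced module. -/
def monodromy : V.Induced L' σ₀ →ₗ[MaxUnram p L' ⊗[ℚ_[p]] K] V.Induced L' σ₀ where
  -- The factor pⁿ is what Nφ = pφN demands when φ is the shift. It is compatible with equivariance
  -- because r(s) N = p^{α(s)} N r(s).
  toFun F := mk σ₀ (fun n => (p : K) ^ n • V.N (F n)) fun s hs n => by
    rw [map_smul, V.r_N, F.equivariant hs, smul_smul,
      zpow_add₀ PhiNGalMod.natCast_ne_zero_of_algebra]
  map_add' F G := by
    ext n
    exact (congrArg ((p : K) ^ n • ·) (map_add V.N _ _)).trans (smul_add _ _ _)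
  map_smul' r F := by
    ext n
    exact (congrArg ((p : K) ^ n • ·) (map_smul V.N _ _)).trans (smul_comm _ _ _)

lemma monodromy_apply (F : V.Induced L' σ₀) (n : ℤ) :
    monodromy F n = (p : K) ^ n • V.N (F n) := rfl

end Induced

/-! ### The induced module as an object, and its component at σ₀. -/

variable {L' V} [FiniteDimensional ℚ_[p] (MaxUnram p L')]

/-- The `(φ, N, Gal(L'/L))`-module induced by a representation of the Weil–Deligne group that is
unramified over `L'`. -/
def toMod (hV : IsUnramifiedOver L' V) (σ₀ : MaxUnram p L' →ₐ[ℚ_[p]] K) :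
    PhiNGalMod.{w} L' K where
  carrier := V.Induced L' σ₀
  free := Module.Free.of_equiv (Induced.piEquiv σ₀ hV (Module.finBasis K V.carrier))
  finite := Module.Finite.equiv (Induced.piEquiv σ₀ hV (Module.finBasis K V.carrier))
  φ := Induced.shift
  φ_smul l k F := by
    ext n
    have h := frobTwist_zpow σ₀ 1 n l
    rw [zpow_one] at h
    rw [Induced.shift_apply, Induced.smul_apply, Induced.smul_apply, tensorEval_tmul,
      tensorEval_tmul, h, Induced.shift_apply]
  N := Induced.monodromy
  N_φ F := by
    ext n
    have hp : (p : K) ≠ 0 := PhiNGalMod.natCast_ne_zero_of_algebra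
    rw [Induced.nsmul_apply, Induced.shift_apply, Induced.monodromy_apply,
      Induced.monodromy_apply, Induced.shift_apply, ← Nat.cast_smul_eq_nsmul K, smul_smul,
      ← zpow_one_add₀ hp, add_sub_cancel]
  gal := Induced.gal
  gal_smul g l k F := by
    obtain ⟨w, rfl⟩ := exists_weilToGal_eq L' g
    ext n
    rw [Induced.gal_weilToGal, Induced.smul_apply, Induced.weilAct_apply, Induced.weilAct_apply,
      Induced.smul_apply, map_smul, tensorEval_tmul, tensorEval_tmul, galUnram_weilToGal,
      frobTwist_zpow]
  gal_φ g F := by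
    obtain ⟨w, rfl⟩ := exists_weilToGal_eq L' g
    ext n
    rw [Induced.gal_weilToGal, Induced.shift_apply, Induced.weilAct_apply, Induced.weilAct_apply,
      Induced.shift_apply, sub_right_comm]
  gal_N g F := by
    obtain ⟨w, rfl⟩ := exists_weilToGal_eq L' g
    ext n
    have hp : (p : K) ≠ 0 := PhiNGalMod.natCast_ne_zero_of_algebra
    rw [Induced.gal_weilToGal, Induced.monodromy_apply, Induced.weilAct_apply,
      Induced.weilAct_apply, Induced.monodromy_apply, map_smul, V.r_N, smul_smul, ← zpow_add₀ hp,
      sub_add_cancel]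

variable (hV : IsUnramifiedOver L' V) (σ₀ : MaxUnram p L' →ₐ[ℚ_[p]] K)

/-- An element of the induced `(φ, N, Gal(L'/L))`-module as a function. -/
def modEval (F : (toMod hV σ₀).carrier) : ℤ → V.carrier :=
  Induced.eval (L' := L') (V := V) (σ₀ := σ₀) F

variable {hV σ₀}

lemma modEval_ext_range {F G : (toMod hV σ₀).carrier}
    (h : ∀ n ∈ Finset.range (Module.finrank ℚ_[p] (MaxUnram p L')),
      modEval hV σ₀ F n = modEval hV σ₀ G n) : F = G :=
  Induced.ext_range (V := V) (σ₀ := σ₀) h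

lemma modEval_add (F G : (toMod hV σ₀).carrier) (n : ℤ) :
    modEval hV σ₀ (F + G) n = modEval hV σ₀ F n + modEval hV σ₀ G n := rfl

lemma modEval_tensor_smul (r : MaxUnram p L' ⊗[ℚ_[p]] K) (F : (toMod hV σ₀).carrier) (n : ℤ) :
    modEval hV σ₀ (r • F) n = tensorEval σ₀ n r • modEval hV σ₀ F n := rfl

lemma modEval_smul (k : K) (F : (toMod hV σ₀).carrier) (n : ℤ) :
    modEval hV σ₀ (k • F) n = k • modEval hV σ₀ F n := by
  rw [PhiNGalMod.smul_def, modEval_tensor_smul, tensorEval_tmul, map_one, one_mul]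

lemma modEval_φK (F : (toMod hV σ₀).carrier) (n : ℤ) :
    modEval hV σ₀ ((toMod hV σ₀).φK F) n = modEval hV σ₀ F (n - 1) := rfl

lemma modEval_NK (F : (toMod hV σ₀).carrier) (n : ℤ) :
    modEval hV σ₀ ((toMod hV σ₀).NK F) n = (p : K) ^ n • V.N (modEval hV σ₀ F n) := rfl

lemma modEval_galK (w : weilGroup L) (F : (toMod hV σ₀).carrier) (n : ℤ) :
    modEval hV σ₀ ((toMod hV σ₀).galK (weilToGal L' w) F) n =
      V.r w (modEval hV σ₀ F (n - frobExp w)) :=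
  congrArg (fun e : AddMonoid.End (V.Induced L' σ₀) => Induced.eval (e F) n)
    (Induced.gal_weilToGal w)

lemma modEval_φK_zpow (m : ℤ) (F : (toMod hV σ₀).carrier) (n : ℤ) :
    modEval hV σ₀ (((toMod hV σ₀).φK ^ m) F) n = modEval hV σ₀ F (n - m) := by
  induction m generalizing F with
  | zero => simp
  | succ m ih => rw [zpow_add_one, LinearEquiv.mul_apply, ih, modEval_φK, sub_sub]
  | pred m ih =>
    obtain ⟨F, rfl⟩ := (toMod hV σ₀).φK.surjective F
    rw [← LinearEquiv.mul_apply, ← zpow_add_one, sub_add_cancel, ih, modEval_φK]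
    congr 1
    ring

/-- The translation by α(w) in the Galois action cancels the one in φ^{-α(w)}, which leaves r(w)
acting on values. -/
lemma modEval_weilEnd_zero (w : weilGroup L) (F : (toMod hV σ₀).carrier) :
    modEval hV σ₀ ((toMod hV σ₀).weilEnd w F) 0 = V.r w (modEval hV σ₀ F 0) := by
  rw [PhiNGalMod.weilEnd_apply, modEval_galK, modEval_φK_zpow]
  congr 2
  ring

/-- On values at n, l acts through σ₀ ∘ φ₀⁻ⁿ, which equals σ₀ exactly when f divides n. So this
component consists of the functions supported on fℤ. -/
lemma mem_component_toMod {F : (toMod hV σ₀).carrier} :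
    F ∈ (toMod hV σ₀).component σ₀ ↔
      ∀ n : ℤ, ¬ (Module.finrank ℚ_[p] (MaxUnram p L') : ℤ) ∣ n → modEval hV σ₀ F n = 0 := by
  constructor
  · intro hF n hn
    rw [← sub_zero n, ← frobTwist_eq_iff σ₀, DFunLike.ext_iff, not_forall] at hn
    obtain ⟨l, hl⟩ := hn
    have h := congrArg (fun G => modEval hV σ₀ G n) (hF l)
    simp only [modEval_tensor_smul, modEval_smul, tensorEval_tmul, mul_one] at h
    rw [frobTwist_zero] at hl
    rw [← sub_eq_zero, ← sub_smul] at h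
    exact (smul_eq_zero.1 h).resolve_left (sub_ne_zero.2 hl)
  · intro hF l
    refine Induced.ext (V := V) (σ₀ := σ₀) fun n => ?_
    change modEval hV σ₀ ((l ⊗ₜ[ℚ_[p]] (1 : K)) • F) n = modEval hV σ₀ (σ₀ l • F) n
    rw [modEval_tensor_smul, modEval_smul, tensorEval_tmul, mul_one]
    by_cases hn : (Module.finrank ℚ_[p] (MaxUnram p L') : ℤ) ∣ n
    · rw [(frobTwist_eq_iff σ₀ (m := n) (n := 0)).2 (by rwa [sub_zero]), frobTwist_zero]
    · rw [hF n hn, smul_zero, smul_zero]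

variable (hV σ₀) in
/-- Evaluation at `0` on the component of `σ₀` of the induced module. -/
def evalZeroHom : (toMod hV σ₀).component σ₀ →ₗ[K] V.carrier where
  toFun F := modEval hV σ₀ (F : (toMod hV σ₀).carrier) 0
  map_add' _ _ := modEval_add _ _ _
  map_smul' _ _ := modEval_smul _ _ _

variable (hV σ₀) in
/-- Evaluation at `0` identifies the component of `σ₀` of the induced module with `V`. -/
def evalZero : (toMod hV σ₀).component σ₀ ≃ₗ[K] V.carrier :=
  LinearEquiv.ofBijective (evalZeroHom hV σ₀) (by
    constructor
    · rw [injective_iff_map_eq_zero]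
      intro F hF
      refine Subtype.ext (modEval_ext_range fun n hn => ?_)
      rcases Nat.eq_zero_or_pos n with rfl | hn0
      · exact hF
      · refine mem_component_toMod.1 F.2 n fun hdvd => ?_
        rw [Int.natCast_dvd_natCast] at hdvd
        exact (Nat.le_of_dvd hn0 hdvd).not_gt (Finset.mem_range.1 hn)
    · intro v
      -- The preimage of v is the equivariant function with value v at 0 and value 0 at 1, …, f - 1.
      let G : (toMod hV σ₀).carrier :=
        id (Induced.periodize σ₀ hV fun n => if n = 0 then v else 0)
      have hG : G ∈ (toMod hV σ₀).component σ₀ := mem_component_toMod.2 fun n hn => by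
        refine (Induced.periodize_apply hV _ n).trans ?_
        rw [if_neg fun h => hn (Int.dvd_of_emod_eq_zero h), map_zero]
      have h0 := Induced.periodize_apply_of_mem (σ₀ := σ₀) hV (fun n => if n = 0 then v else 0)
        (Finset.mem_range.2 Module.finrank_pos)
      rw [Nat.cast_zero, if_pos rfl] at h0
      exact ⟨⟨G, hG⟩, h0⟩)

/-- An isomorphism of representations of the Weil–Deligne group from an equivariant linear
equivalence. -/
def isoOfLinearEquiv {V W : WeilDeligneRep.{w} L K} (e : V.carrier ≃ₗ[K] W.carrier)
    (hr : ∀ w v, e (V.r w v) = W.r w (e v)) (hN : ∀ v, e (V.N v) = W.N (e v)) : V ≅ W where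
  hom := ⟨e, hr, hN⟩
  inv := ⟨e.symm, fun w v => by
    obtain ⟨v, rfl⟩ := e.surjective v
    simp [← hr], fun v => by
    obtain ⟨v, rfl⟩ := e.surjective v
    simp [← hN]⟩
  hom_inv_id := Hom.ext (by ext v; exact e.symm_apply_apply v)
  inv_hom_id := Hom.ext (by ext v; exact e.apply_symm_apply v)

/-- The representation attached to the induced module is the original one. -/
def toWDToModIso [FiniteDimensional ℚ_[p] K] [FiniteDimensional L L']
    (hV : IsUnramifiedOver L' V) (σ₀ : MaxUnram p L' →ₐ[ℚ_[p]] K) : (toMod hV σ₀).toWD σ₀ ≅ V :=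
  isoOfLinearEquiv (evalZero hV σ₀) (fun w F => modEval_weilEnd_zero w F.1) (fun F => by
    -- At n = 0 the factor pⁿ in the monodromy operator is 1.
    refine (modEval_NK F.1 0).trans ?_
    rw [zpow_zero, one_smul]
    rfl)

end WeilDeligneRep

end FontaineWD

end

/-! ### The equivalence of categories. -/

theorem proposition4p1 (p : ℕ) [Fact p.Prime]
    (L : IntermediateField ℚ_[p] (PadicAlgCl p)) [FiniteDimensional ℚ_[p] L]
    (L' : IntermediateField L (PadicAlgCl p)) [FiniteDimensional L L'] [IsGalois L L']
    (K : Type u) [Field K] [Algebra ℚ_[p] K] [FiniteDimensional ℚ_[p] K]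
    (hK : Module.finrank ℚ_[p] (FontaineWD.MaxUnram p L') =
      Nat.card (FontaineWD.MaxUnram p L' →ₐ[ℚ_[p]] K))
    (σ₀ : FontaineWD.MaxUnram p L' →ₐ[ℚ_[p]] K) :
    (FontaineWD.WD L' K σ₀ :
      CategoryTheory.Functor (FontaineWD.PhiNGalMod.{w} L' K)
        (FontaineWD.WeilDeligneRep.IsUnramifiedOver.{w} (K := K)
          L').FullSubcategory).IsEquivalence := by
  have : FiniteDimensional ℚ_[p] (FontaineWD.MaxUnram p L') :=
    FiniteDimensional.of_injective σ₀.toLinearMap σ₀.injective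
  exact
    { faithful := ⟨fun {D D'} f g h => FontaineWD.PhiNGalMod.hom_ext_of_component σ₀
        (congrArg (fun e => FontaineWD.WeilDeligneRep.Hom.toLinearMap e.hom) h)⟩
      full := ⟨fun {D D'} f => ⟨FontaineWD.PhiNGalMod.homOfComponent f.hom.toLinearMap
        (fun w d => congrArg Subtype.val (f.hom.r_comm w d))
        (fun d => congrArg Subtype.val (f.hom.N_comm d)), by
          apply CategoryTheory.ObjectProperty.hom_ext
          exact FontaineWD.WeilDeligneRep.Hom.ext
            (FontaineWD.PhiNGalMod.component_homOfComponent _ _ _)⟩⟩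
      essSurj := ⟨fun V => ⟨FontaineWD.WeilDeligneRep.toMod V.property σ₀, ⟨CategoryTheory.ObjectProperty.isoMk _
        (FontaineWD.WeilDeligneRep.toWDToModIso V.property σ₀)⟩⟩⟩ }
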